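/- Let $K$ be a field. A *dendriform algebra* is a $K$-vector space with bilinear products $\prec,\succ$ such that $(x\prec y)\prec z=x\prec(y\prec z+y\succ z)$, $(x\succ y)\prec z=x\succ(y\prec z)$ and $x\succ(y\succ z)=(x\succ y+x\prec y)\succ z$. For a dendriform algebra $D$, the associated unital dendriform algebra is $\widetilde D=K\cdot 1\oplus D$, with $x\prec 1=1\succ x=x$ and $1\prec x=x\succ 1=0$ for $x\in D$ ($1\prec 1$ and $1\succ 1$ are not defined), and $x*y=x\prec y+x\succ y$, $1*1=1$. A morphism $\widetilde D\to\widetilde D'$ is a linear map preserving $1$ and restricting to a dendriform morphism $D\to D'$. In $\widetilde D$ put $\nearrow(x_1,\dots,x_n)=x_1\prec(x_2\prec(\cdots\prec x_n))$, $\searrow(x_1,\dots,x_n)=((x_1\succ x_2)\succ\cdots)\succ x_n$, both equal to $1$ for $n=0$, and $$\psi_n(x;y_1,\dots,y_n)=\sum_{i=0}^n(-1)^i\,\nearrow(y_1,\dots,y_i)\succ x\prec\,\searrow(y_{i+1},\dots,y_n).$$ A *brace algebra* is a $K$-vector space $B$ with multilinear operations $\{x\mid y_1,\dots,y_n\}$,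 $n\ge1$, such that, with $\{x\mid\ \}=x$, $$\{\{z\mid x_1,\dots,x_n\}\mid y_1,\dots,y_m\}=\sum\{z\mid Y_0,\{x_1\mid Y_1\},Y_2,\dots,\{x_n\mid Y_{2n-1}\},Y_{2n}\},$$ the sum being over the decompositions of the ordered list $y_1,\dots,y_m$ into successive, possibly empty, intervals $Y_0,\dots,Y_{2n}$. Its enveloping dendriform algebra $\mathcal U(B)$ is the quotient of the free dendriform algebra on the vector space $B$ by the dendriform ideal generated by all $\psi_n(x;y_1,\dots,y_n)-\{x\mid y_1,\dots,y_n\}$ with $n\ge1$ and $x,y_1,\dots,y_n\in B$. The algebra $\widetilde{\mathcal U}(B)=K\cdot1\oplus\mathcal U(B)$ is a coalgebra: its counit is the projection on $K\cdot 1$, and its coproduct is determined by $\Delta(1)=1\otimes1$, $\Delta(b)=b\otimes1+1\otimes b$ for $b\in B$, and, for $x,y\in\mathcal U(B)$ and $\bullet\in\{\prec,\succ\}$, $$\Delta(x\bullet y)=(x_{(1)}*y_{(1)})\otimes(x_{(2)}\bullet y_{(2)})-(x*y)\otimes(1\bullet1)+(x\bullet y)\otimes1,$$ where the subtraction means that the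 undefined term in $1\bullet 1$ is omitted from the Sweedler sum. Let $Z(V)$ be the free Zinbiel algebra on a vector space $V$, i.e. the free vector space with a bilinear product such that $(x\cdot y)\cdot z=x\cdot(y\cdot z)+x\cdot(z\cdot y)$. It is a dendriform algebra with $x\prec y=y\succ x=x\cdot y$; let $\widetilde Z(V)=K\cdot1\oplus Z(V)$. Let $T^c(V)=\bigoplus_{n\ge0}V^{\otimes n}$, with the deconcatenation coproduct $v_1\otimes\cdots\otimes v_n\mapsto\sum_{i=0}^n(v_1\otimes\cdots\otimes v_i)\otimes(v_{i+1}\otimes\cdots\otimes v_n)$ and the projection on $V^{\otimes 0}=K$ as counit. **Proposition.** Let $V$ be a trivial brace algebra, i.e. one in which $\{x\mid y_1,\dots,y_n\}=0$ for all $n\ge1$. 1. There is a unique isomorphism of unital dendriform algebras $\theta:\widetilde{\mathcal U}(V)\to\widetilde Z(V)$ that is the identity on $V$. 2. Moreover, $\theta$ is an isomorphism of coalgebras, when $\widetilde Z(V)$ is identified with the coalgebra $T^c(V)$ by the linear isomorphism $T^c(V)\to\widetilde Z(V)$, $v_1\otimes\cdots\otimes v_n\mapsto\,\searrow(v_1,\dots,v_n)=v_n\cdot(v_{n-1}\cdot(\cdots\cdot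 v_1))$ (with $1\mapsto1$). If one uses instead the linear isomorphism $v_1\otimes\cdots\otimes v_n\mapsto\,\nearrow(v_1,\dots,v_n)=v_1\cdot(v_2\cdot(\cdots\cdot v_n))$, then $\theta$ preserves the counit and exchanges the two tensor factors of the coproduct. -/

import Mathlib

open scoped TensorProduct

noncomputable section

namespace BraceDend

/-! ### Dendriform algebras and their ideals -/

/-- A dendriform algebra: a vector space with two bilinear products
`left x y` (written `x ≺ y`) and `right x y` (written `x ≻ y`). -/
class Dendriform (K : Type*) (W : Type*) [Field K] [AddCommGroup W] [Module K W] where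
  left : W →ₗ[K] W →ₗ[K] W
  right : W →ₗ[K] W →ₗ[K] W
  left_left : ∀ x y z, left (left x y) z = left x (left y z) + left x (right y z)
  right_left : ∀ x y z, left (right x y) z = right x (left y z)
  right_right : ∀ x y z, right x (right y z) = right (right x y) z + right (left x y) z

section Ideals

variable (K : Type*) {W : Type*} [Field K] [AddCommGroup W] [Module K W] [Dendriform K W]

/-- A two-sided ideal of a dendriform algebra (for both products). -/
def IsDendIdeal (I : Submodule K W) : Prop :=
  ∀ a ∈ I, ∀ w : W, Dendriform.left (K := K) a w ∈ I ∧ Dendriform.left (K := K) w a ∈ I ∧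
    Dendriform.right (K := K) a w ∈ I ∧ Dendriform.right (K := K) w a ∈ I

/-- The dendriform ideal generated by a set: the smallest ideal containing it. -/
def dendIdeal (S : Set W) : Submodule K W :=
  sInf {I : Submodule K W | S ⊆ I ∧ IsDendIdeal K I}

variable {K}

theorem subset_dendIdeal (S : Set W) : S ⊆ dendIdeal K S := fun s hs => by
  simp only [dendIdeal, SetLike.mem_coe, Submodule.mem_sInf]
  exact fun I hI => hI.1 hs

theorem dendIdeal_le {S : Set W} {I : Submodule K W} (h : S ⊆ I) (hI : IsDendIdeal K I) :
    dendIdeal K S ≤ I := sInf_le ⟨h, hI⟩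

theorem isDendIdeal_dendIdeal (S : Set W) : IsDendIdeal K (dendIdeal K S) := by
  intro a ha w
  simp only [dendIdeal, Submodule.mem_sInf] at ha ⊢
  exact ⟨fun I hI => (hI.2 a (ha I hI) w).1, fun I hI => (hI.2 a (ha I hI) w).2.1,
    fun I hI => (hI.2 a (ha I hI) w).2.2.1, fun I hI => (hI.2 a (ha I hI) w).2.2.2⟩

/-- The quotient of a dendriform algebra by the ideal generated by a set,
with the products induced on classes. -/
instance instDendriformQuotient (S : Set W) : Dendriform K (W ⧸ dendIdeal K S) where
  left := LinearMap.liftQ₂ (dendIdeal K S) (dendIdeal K S)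
    ((Dendriform.left (K := K)).compr₂ (dendIdeal K S).mkQ)
    (fun a ha => by
      ext w
      simpa using (isDendIdeal_dendIdeal S a ha w).1)
    (fun a ha => by
      ext w
      simpa using (isDendIdeal_dendIdeal S a ha w).2.1)
  right := LinearMap.liftQ₂ (dendIdeal K S) (dendIdeal K S)
    ((Dendriform.right (K := K)).compr₂ (dendIdeal K S).mkQ)
    (fun a ha => by
      ext w
      simpa using (isDendIdeal_dendIdeal S a ha w).2.2.1)
    (fun a ha => by
      ext w
      simpa using (isDendIdeal_dendIdeal S a ha w).2.2.2)
  left_left := by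
    intro x y z
    obtain ⟨x, rfl⟩ := Submodule.mkQ_surjective _ x
    obtain ⟨y, rfl⟩ := Submodule.mkQ_surjective _ y
    obtain ⟨z, rfl⟩ := Submodule.mkQ_surjective _ z
    exact congrArg (dendIdeal K S).mkQ (Dendriform.left_left x y z)
  right_left := by
    intro x y z
    obtain ⟨x, rfl⟩ := Submodule.mkQ_surjective _ x
    obtain ⟨y, rfl⟩ := Submodule.mkQ_surjective _ y
    obtain ⟨z, rfl⟩ := Submodule.mkQ_surjective _ z
    exact congrArg (dendIdeal K S).mkQ (Dendriform.right_left x y z)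
  right_right := by
    intro x y z
    obtain ⟨x, rfl⟩ := Submodule.mkQ_surjective _ x
    obtain ⟨y, rfl⟩ := Submodule.mkQ_surjective _ y
    obtain ⟨z, rfl⟩ := Submodule.mkQ_surjective _ z
    exact congrArg (dendIdeal K S).mkQ (Dendriform.right_right x y z)

theorem mkQ_left (S : Set W) (x y : W) : (dendIdeal K S).mkQ (Dendriform.left (K := K) x y) =
    Dendriform.left (K := K) ((dendIdeal K S).mkQ x) ((dendIdeal K S).mkQ y) := rfl

theorem mkQ_right (S : Set W) (x y : W) : (dendIdeal K S).mkQ (Dendriform.right (K := K) x y) =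
    Dendriform.right (K := K) ((dendIdeal K S).mkQ x) ((dendIdeal K S).mkQ y) := rfl

end Ideals

/-! ### The free dendriform algebra on a vector space -/

/-- Formal expressions in the operations of a dendriform algebra. -/
inductive DTerm (K : Type*) (V : Type*)
  | of : V → DTerm K V
  | zero : DTerm K V
  | add : DTerm K V → DTerm K V → DTerm K V
  | smul : K → DTerm K V → DTerm K V
  | left : DTerm K V → DTerm K V → DTerm K V
  | right : DTerm K V → DTerm K V → DTerm K V

/-- The relations forcing: vector space axioms, linearity of the inclusion of `V`, bilinearity of
the two products and the three dendriform identities. -/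
inductive DRel (K : Type*) (V : Type*) [Field K] [AddCommGroup V] [Module K V] :
    DTerm K V → DTerm K V → Prop
  | of_add (a b : V) : DRel K V (.of (a + b)) (.add (.of a) (.of b))
  | of_smul (c : K) (a : V) : DRel K V (.of (c • a)) (.smul c (.of a))
  | add_comm (a b) : DRel K V (.add a b) (.add b a)
  | add_assoc (a b c) : DRel K V (.add (.add a b) c) (.add a (.add b c))
  | zero_add (a) : DRel K V (.add .zero a) a
  | one_smul (a) : DRel K V (.smul 1 a) a
  | zero_smul (a) : DRel K V (.smul 0 a) .zero
  | mul_smul (c d : K) (a) : DRel K V (.smul (c * d) a) (.smul c (.smul d a))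
  | add_smul (c d : K) (a) : DRel K V (.smul (c + d) a) (.add (.smul c a) (.smul d a))
  | smul_add (c : K) (a b) : DRel K V (.smul c (.add a b)) (.add (.smul c a) (.smul c b))
  | add_left (a b c) : DRel K V (.left (.add a b) c) (.add (.left a c) (.left b c))
  | left_add (a b c) : DRel K V (.left a (.add b c)) (.add (.left a b) (.left a c))
  | smul_left (r : K) (a b) : DRel K V (.left (.smul r a) b) (.smul r (.left a b))
  | left_smul (r : K) (a b) : DRel K V (.left a (.smul r b)) (.smul r (.left a b))
  | add_right (a b c) : DRel K V (.right (.add a b) c) (.add (.right a c) (.right b c))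
  | right_add (a b c) : DRel K V (.right a (.add b c)) (.add (.right a b) (.right a c))
  | smul_right (r : K) (a b) : DRel K V (.right (.smul r a) b) (.smul r (.right a b))
  | right_smul (r : K) (a b) : DRel K V (.right a (.smul r b)) (.smul r (.right a b))
  | left_left (a b c) :
      DRel K V (.left (.left a b) c) (.add (.left a (.left b c)) (.left a (.right b c)))
  | right_left (a b c) : DRel K V (.left (.right a b) c) (.right a (.left b c))
  | right_right (a b c) :
      DRel K V (.right a (.right b c)) (.add (.right (.right a b) c) (.right (.left a b) c))
  | congr_add_l (a a' b) : DRel K V a a' → DRel K V (.add a b) (.add a' b)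
  | congr_add_r (a b b') : DRel K V b b' → DRel K V (.add a b) (.add a b')
  | congr_smul (c : K) (a a') : DRel K V a a' → DRel K V (.smul c a) (.smul c a')
  | congr_left_l (a a' b) : DRel K V a a' → DRel K V (.left a b) (.left a' b)
  | congr_left_r (a b b') : DRel K V b b' → DRel K V (.left a b) (.left a b')
  | congr_right_l (a a' b) : DRel K V a a' → DRel K V (.right a b) (.right a' b)
  | congr_right_r (a b b') : DRel K V b b' → DRel K V (.right a b) (.right a b')

/-- The free dendriform algebra `D(V)` on a vector space `V`. -/
def FreeDend (K : Type*) (V : Type*) [Field K] [AddCommGroup V] [Module K V] : Type _ :=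
  Quot (DRel K V)

namespace FreeDend

variable (K : Type*) {V : Type*} [Field K] [AddCommGroup V] [Module K V]

instance instZero : Zero (FreeDend K V) := ⟨Quot.mk _ DTerm.zero⟩

instance instAdd : Add (FreeDend K V) :=
  ⟨Quot.map₂ DTerm.add (fun a _ _ h => .congr_add_r a _ _ h) (fun _ _ b h => .congr_add_l _ _ b h)⟩

instance instAddCommMonoid : AddCommMonoid (FreeDend K V) where
  add_assoc := by
    rintro ⟨a⟩ ⟨b⟩ ⟨c⟩
    exact Quot.sound (.add_assoc a b c)
  zero_add := by
    rintro ⟨a⟩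
    exact Quot.sound (.zero_add a)
  add_zero := by
    rintro ⟨a⟩
    exact (Quot.sound (.add_comm a .zero)).trans (Quot.sound (.zero_add a))
  add_comm := by
    rintro ⟨a⟩ ⟨b⟩
    exact Quot.sound (.add_comm a b)
  nsmul := nsmulRec

instance instModule : Module K (FreeDend K V) where
  smul c := Quot.map (DTerm.smul c) (fun _ _ h => .congr_smul c _ _ h)
  one_smul := by
    rintro ⟨a⟩
    exact Quot.sound (.one_smul a)
  mul_smul := by
    rintro c d ⟨a⟩
    exact Quot.sound (.mul_smul c d a)
  smul_add := by
    rintro c ⟨a⟩ ⟨b⟩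
    exact Quot.sound (.smul_add c a b)
  add_smul := by
    rintro c d ⟨a⟩
    exact Quot.sound (.add_smul c d a)
  zero_smul := by
    rintro ⟨a⟩
    exact Quot.sound (.zero_smul a)
  smul_zero := by
    intro c
    have h : (Quot.mk _ (DTerm.smul c DTerm.zero) : FreeDend K V) =
        Quot.mk _ (DTerm.smul c (DTerm.smul 0 DTerm.zero)) :=
      Quot.sound (.congr_smul c _ _ (.zero_smul _)) |>.symm
    refine h.trans ((Quot.sound (.mul_smul c 0 .zero)).symm.trans ?_)
    rw [mul_zero]
    exact Quot.sound (.zero_smul _)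

instance instNeg : Neg (FreeDend K V) := ⟨fun a => (-1 : K) • a⟩

instance instAddCommGroup : AddCommGroup (FreeDend K V) :=
  { instAddCommMonoid K with
    zsmul := zsmulRec
    neg_add_cancel := fun a => by
      change (-1 : K) • a + a = 0
      conv_lhs => rw [← one_smul K a, smul_smul, ← add_smul]
      simp }

instance instDendriform : Dendriform K (FreeDend K V) where
  left := LinearMap.mk₂ K
    (Quot.map₂ DTerm.left (fun a _ _ h => .congr_left_r a _ _ h)
      (fun _ _ b h => .congr_left_l _ _ b h))
    (by
      rintro ⟨a⟩ ⟨b⟩ ⟨c⟩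
      exact Quot.sound (.add_left a b c))
    (by
      rintro r ⟨a⟩ ⟨b⟩
      exact Quot.sound (.smul_left r a b))
    (by
      rintro ⟨a⟩ ⟨b⟩ ⟨c⟩
      exact Quot.sound (.left_add a b c))
    (by
      rintro r ⟨a⟩ ⟨b⟩
      exact Quot.sound (.left_smul r a b))
  right := LinearMap.mk₂ K
    (Quot.map₂ DTerm.right (fun a _ _ h => .congr_right_r a _ _ h)
      (fun _ _ b h => .congr_right_l _ _ b h))
    (by
      rintro ⟨a⟩ ⟨b⟩ ⟨c⟩
      exact Quot.sound (.add_right a b c))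
    (by
      rintro r ⟨a⟩ ⟨b⟩
      exact Quot.sound (.smul_right r a b))
    (by
      rintro ⟨a⟩ ⟨b⟩ ⟨c⟩
      exact Quot.sound (.right_add a b c))
    (by
      rintro r ⟨a⟩ ⟨b⟩
      exact Quot.sound (.right_smul r a b))
  left_left := by
    rintro ⟨a⟩ ⟨b⟩ ⟨c⟩
    exact Quot.sound (.left_left a b c)
  right_left := by
    rintro ⟨a⟩ ⟨b⟩ ⟨c⟩
    exact Quot.sound (.right_left a b c)
  right_right := by
    rintro ⟨a⟩ ⟨b⟩ ⟨c⟩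
    exact Quot.sound (.right_right a b c)

/-- The inclusion of generators `V → D(V)`. -/
def of : V →ₗ[K] FreeDend K V where
  toFun v := Quot.mk _ (DTerm.of v)
  map_add' a b := Quot.sound (.of_add a b)
  map_smul' c a := Quot.sound (.of_smul c a)

variable {K}

/-- `D(V)` is generated by `V`. -/
theorem induction {p : FreeDend K V → Prop} (of : ∀ v, p (of K v)) (zero : p 0)
    (add : ∀ a b, p a → p b → p (a + b)) (smul : ∀ (c : K) a, p a → p (c • a))
    (left : ∀ a b, p a → p b → p (Dendriform.left (K := K) a b))
    (right : ∀ a b, p a → p b → p (Dendriform.right (K := K) a b)) (x : FreeDend K V) : p x := by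
  obtain ⟨t⟩ := x
  induction t with
  | of v => exact of v
  | zero => exact zero
  | add a b ha hb => exact add _ _ ha hb
  | smul c a ha => exact smul c _ ha
  | left a b ha hb => exact left _ _ ha hb
  | right a b ha hb => exact right _ _ ha hb

section Lift

variable {W : Type*} [AddCommGroup W] [Module K W] [Dendriform K W] (f : V →ₗ[K] W)

/-- Evaluation of formal expressions in a dendriform algebra. -/
def valueOf : DTerm K V → W
  | .of v => f v
  | .zero => 0
  | .add a b => valueOf a + valueOf b
  | .smul c a => c • valueOf a
  | .left a b => Dendriform.left (K := K) (valueOf a) (valueOf b)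
  | .right a b => Dendriform.right (K := K) (valueOf a) (valueOf b)

theorem valueOf_rel {a b : DTerm K V} (h : DRel K V a b) : valueOf f a = valueOf f b := by
  induction h with
  | add_comm a b => exact _root_.add_comm _ _
  | add_assoc a b c => exact _root_.add_assoc _ _ _
  | mul_smul c d a => exact SemigroupAction.mul_smul _ _ _
  | add_smul c d a => exact _root_.add_smul _ _ _
  | left_left a b c => exact Dendriform.left_left _ _ _
  | right_left a b c => exact Dendriform.right_left _ _ _
  | right_right a b c => exact Dendriform.right_right _ _ _
  | _ => simp_all [valueOf]

/-- The universal property of `D(V)`: a linear map to a dendriform algebra extends to `D(V)`. -/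
def lift : FreeDend K V →ₗ[K] W where
  toFun := Quot.lift (valueOf f) (fun _ _ h => valueOf_rel f h)
  map_add' := by
    rintro ⟨a⟩ ⟨b⟩
    rfl
  map_smul' := by
    rintro c ⟨a⟩
    rfl

@[simp] theorem lift_of (v : V) : lift f (of K v) = f v := rfl

theorem lift_left (x y : FreeDend K V) : lift f (Dendriform.left (K := K) x y) =
    Dendriform.left (K := K) (lift f x) (lift f y) := by
  obtain ⟨x⟩ := x
  obtain ⟨y⟩ := y
  rfl

theorem lift_right (x y : FreeDend K V) : lift f (Dendriform.right (K := K) x y) =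
    Dendriform.right (K := K) (lift f x) (lift f y) := by
  obtain ⟨x⟩ := x
  obtain ⟨y⟩ := y
  rfl

end Lift

end FreeDend

/-! ### Zinbiel algebras and the free Zinbiel algebra on a vector space -/

/-- A Zinbiel (dual Leibniz) algebra. -/
class Zinbiel (K : Type*) (W : Type*) [Field K] [AddCommGroup W] [Module K W] where
  mul : W →ₗ[K] W →ₗ[K] W
  mul_mul : ∀ x y z, mul (mul x y) z = mul x (mul y z) + mul x (mul z y)

/-- A Zinbiel algebra seen as a symmetric dendriform algebra: `x ≺ y = y ≻ x = x · y`. -/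
@[reducible] def Zinbiel.toDendriform (K : Type*) (W : Type*) [Field K] [AddCommGroup W]
    [Module K W] [Zinbiel K W] : Dendriform K W where
  left := Zinbiel.mul
  right := Zinbiel.mul.flip
  left_left x y z := by simpa using Zinbiel.mul_mul x y z
  right_left x y z := by simp [Zinbiel.mul_mul, add_comm]
  right_right x y z := by simp [Zinbiel.mul_mul]

/-- Formal expressions in the operations of a Zinbiel algebra. -/
inductive ZTerm (K : Type*) (V : Type*)
  | of : V → ZTerm K V
  | zero : ZTerm K V
  | add : ZTerm K V → ZTerm K V → ZTerm K V
  | smul : K → ZTerm K V → ZTerm K V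
  | mul : ZTerm K V → ZTerm K V → ZTerm K V

/-- The relations forcing: vector space axioms, linearity of the inclusion of `V`, bilinearity of
the product and the Zinbiel identity. -/
inductive ZRel (K : Type*) (V : Type*) [Field K] [AddCommGroup V] [Module K V] :
    ZTerm K V → ZTerm K V → Prop
  | of_add (a b : V) : ZRel K V (.of (a + b)) (.add (.of a) (.of b))
  | of_smul (c : K) (a : V) : ZRel K V (.of (c • a)) (.smul c (.of a))
  | add_comm (a b) : ZRel K V (.add a b) (.add b a)
  | add_assoc (a b c) : ZRel K V (.add (.add a b) c) (.add a (.add b c))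
  | zero_add (a) : ZRel K V (.add .zero a) a
  | one_smul (a) : ZRel K V (.smul 1 a) a
  | zero_smul (a) : ZRel K V (.smul 0 a) .zero
  | mul_smul (c d : K) (a) : ZRel K V (.smul (c * d) a) (.smul c (.smul d a))
  | add_smul (c d : K) (a) : ZRel K V (.smul (c + d) a) (.add (.smul c a) (.smul d a))
  | smul_add (c : K) (a b) : ZRel K V (.smul c (.add a b)) (.add (.smul c a) (.smul c b))
  | add_mul (a b c) : ZRel K V (.mul (.add a b) c) (.add (.mul a c) (.mul b c))
  | mul_add (a b c) : ZRel K V (.mul a (.add b c)) (.add (.mul a b) (.mul a c))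
  | smul_mul (r : K) (a b) : ZRel K V (.mul (.smul r a) b) (.smul r (.mul a b))
  | mul_smul' (r : K) (a b) : ZRel K V (.mul a (.smul r b)) (.smul r (.mul a b))
  | mul_mul (a b c) :
      ZRel K V (.mul (.mul a b) c) (.add (.mul a (.mul b c)) (.mul a (.mul c b)))
  | congr_add_l (a a' b) : ZRel K V a a' → ZRel K V (.add a b) (.add a' b)
  | congr_add_r (a b b') : ZRel K V b b' → ZRel K V (.add a b) (.add a b')
  | congr_smul (c : K) (a a') : ZRel K V a a' → ZRel K V (.smul c a) (.smul c a')
  | congr_mul_l (a a' b) : ZRel K V a a' → ZRel K V (.mul a b) (.mul a' b)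
  | congr_mul_r (a b b') : ZRel K V b b' → ZRel K V (.mul a b) (.mul a b')

/-- The free Zinbiel algebra `Z(V)` on a vector space `V`. -/
def FreeZin (K : Type*) (V : Type*) [Field K] [AddCommGroup V] [Module K V] : Type _ :=
  Quot (ZRel K V)

namespace FreeZin

variable (K : Type*) {V : Type*} [Field K] [AddCommGroup V] [Module K V]

instance instZero : Zero (FreeZin K V) := ⟨Quot.mk _ ZTerm.zero⟩

instance instAdd : Add (FreeZin K V) :=
  ⟨Quot.map₂ ZTerm.add (fun a _ _ h => .congr_add_r a _ _ h) (fun _ _ b h => .congr_add_l _ _ b h)⟩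

instance instAddCommMonoid : AddCommMonoid (FreeZin K V) where
  add_assoc := by
    rintro ⟨a⟩ ⟨b⟩ ⟨c⟩
    exact Quot.sound (.add_assoc a b c)
  zero_add := by
    rintro ⟨a⟩
    exact Quot.sound (.zero_add a)
  add_zero := by
    rintro ⟨a⟩
    exact (Quot.sound (.add_comm a .zero)).trans (Quot.sound (.zero_add a))
  add_comm := by
    rintro ⟨a⟩ ⟨b⟩
    exact Quot.sound (.add_comm a b)
  nsmul := nsmulRec

instance instModule : Module K (FreeZin K V) where
  smul c := Quot.map (ZTerm.smul c) (fun _ _ h => .congr_smul c _ _ h)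
  one_smul := by
    rintro ⟨a⟩
    exact Quot.sound (.one_smul a)
  mul_smul := by
    rintro c d ⟨a⟩
    exact Quot.sound (.mul_smul c d a)
  smul_add := by
    rintro c ⟨a⟩ ⟨b⟩
    exact Quot.sound (.smul_add c a b)
  add_smul := by
    rintro c d ⟨a⟩
    exact Quot.sound (.add_smul c d a)
  zero_smul := by
    rintro ⟨a⟩
    exact Quot.sound (.zero_smul a)
  smul_zero := by
    intro c
    have h : (Quot.mk _ (ZTerm.smul c ZTerm.zero) : FreeZin K V) =
        Quot.mk _ (ZTerm.smul c (ZTerm.smul 0 ZTerm.zero)) :=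
      Quot.sound (.congr_smul c _ _ (.zero_smul _)) |>.symm
    refine h.trans ((Quot.sound (.mul_smul c 0 .zero)).symm.trans ?_)
    rw [mul_zero]
    exact Quot.sound (.zero_smul _)

instance instNeg : Neg (FreeZin K V) := ⟨fun a => (-1 : K) • a⟩

instance instAddCommGroup : AddCommGroup (FreeZin K V) :=
  { instAddCommMonoid K with
    zsmul := zsmulRec
    neg_add_cancel := fun a => by
      change (-1 : K) • a + a = 0
      conv_lhs => rw [← one_smul K a, smul_smul, ← add_smul]
      simp }

instance instZinbiel : Zinbiel K (FreeZin K V) where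
  mul := LinearMap.mk₂ K
    (Quot.map₂ ZTerm.mul (fun a _ _ h => .congr_mul_r a _ _ h)
      (fun _ _ b h => .congr_mul_l _ _ b h))
    (by
      rintro ⟨a⟩ ⟨b⟩ ⟨c⟩
      exact Quot.sound (.add_mul a b c))
    (by
      rintro r ⟨a⟩ ⟨b⟩
      exact Quot.sound (.smul_mul r a b))
    (by
      rintro ⟨a⟩ ⟨b⟩ ⟨c⟩
      exact Quot.sound (.mul_add a b c))
    (by
      rintro r ⟨a⟩ ⟨b⟩
      exact Quot.sound (.mul_smul' r a b))
  mul_mul := by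
    rintro ⟨a⟩ ⟨b⟩ ⟨c⟩
    exact Quot.sound (.mul_mul a b c)

instance instDendriform : Dendriform K (FreeZin K V) := Zinbiel.toDendriform K (FreeZin K V)

/-- The inclusion of generators `V → Z(V)`. -/
def of : V →ₗ[K] FreeZin K V where
  toFun v := Quot.mk _ (ZTerm.of v)
  map_add' a b := Quot.sound (.of_add a b)
  map_smul' c a := Quot.sound (.of_smul c a)

end FreeZin

/-! ### Unital dendriform algebras -/

/-- A unital dendriform algebra `W = K·1 ⊕ V`. The decomposition is recorded by the projection
`aug : W → K` on `K·1` parallel to `V`, so that `V = ker aug`. The products are only meaningful on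
`V ⊗ W + W ⊗ V`; the total bilinear maps below are normalised by giving the undefined
expressions `1 ≺ 1` and `1 ≻ 1` the value `0`. -/
class UnitalDendriform (K : Type*) (W : Type*) [Field K] [AddCommGroup W] [Module K W] where
  one : W
  aug : W →ₗ[K] K
  left : W →ₗ[K] W →ₗ[K] W
  right : W →ₗ[K] W →ₗ[K] W
  aug_one : aug one = 1
  aug_left : ∀ x y, aug (left x y) = 0
  aug_right : ∀ x y, aug (right x y) = 0
  left_left : ∀ x y z, aug x = 0 → aug y = 0 → aug z = 0 →
    left (left x y) z = left x (left y z) + left x (right y z)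
  right_left : ∀ x y z, aug x = 0 → aug y = 0 → aug z = 0 →
    left (right x y) z = right x (left y z)
  right_right : ∀ x y z, aug x = 0 → aug y = 0 → aug z = 0 →
    right x (right y z) = right (right x y) z + right (left x y) z
  one_left : ∀ x, aug x = 0 → left one x = 0
  right_one : ∀ x, aug x = 0 → right x one = 0
  left_one : ∀ x, aug x = 0 → left x one = x
  one_right : ∀ x, aug x = 0 → right one x = x
  one_left_one : left one one = 0
  one_right_one : right one one = 0

namespace UnitalDendriform

section Basic

variable {K : Type*} {W : Type*} [Field K] [AddCommGroup W] [Module K W] [UnitalDendriform K W]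

variable (K W) in
/-- The bilinear map `(x, y) ↦ ε(x) ε(y) 1`. -/
def augOne : W →ₗ[K] W →ₗ[K] W :=
  LinearMap.mk₂ K (fun x y => (aug (K := K) x * aug (K := K) y) • one K)
    (by intros; simp [add_mul, add_smul]) (by intros; simp [mul_assoc, mul_smul])
    (by intros; simp [mul_add, add_smul]) (by intros; simp [mul_left_comm, mul_smul])

@[simp] theorem augOne_apply (x y : W) :
    augOne K W x y = (aug (K := K) x * aug (K := K) y) • one K := rfl

variable (K W) in
/-- The associated associative product: `x * y = x ≺ y + x ≻ y` when `x` or `y` lies in `V`,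
and `1 * 1 = 1`. -/
def star : W →ₗ[K] W →ₗ[K] W := left + right + augOne K W

theorem star_apply (x y : W) : star K W x y =
    left (K := K) x y + right (K := K) x y + (aug (K := K) x * aug (K := K) y) • one K := rfl

@[simp] theorem aug_star (x y : W) :
    aug (K := K) (star K W x y) = aug (K := K) x * aug (K := K) y := by
  simp [star_apply, aug_left, aug_right, aug_one]

theorem decomp (x : W) : ∃ (c : K) (x' : W), aug (K := K) x' = 0 ∧ x = c • one K + x' :=
  ⟨aug (K := K) x, x - aug (K := K) x • one K, by simp [aug_one], by abel⟩

@[simp] theorem one_left' (x : W) : left (K := K) (one K) x = 0 := by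
  obtain ⟨c, x, hx, rfl⟩ := decomp (K := K) x
  simp [one_left, one_left_one, hx]

@[simp] theorem right_one' (x : W) : right (K := K) x (one K) = 0 := by
  obtain ⟨c, x, hx, rfl⟩ := decomp (K := K) x
  simp [right_one, one_right_one, hx]

theorem left_one' (x : W) : left (K := K) x (one K) = x - aug (K := K) x • one K := by
  obtain ⟨c, x, hx, rfl⟩ := decomp (K := K) x
  simp [left_one, hx, aug_one]

theorem one_right' (x : W) : right (K := K) (one K) x = x - aug (K := K) x • one K := by
  obtain ⟨c, x, hx, rfl⟩ := decomp (K := K) x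
  simp [one_right, hx, aug_one]

@[simp] theorem star_one (x : W) : star K W x (one K) = x := by
  simp [star_apply, left_one', aug_one]

@[simp] theorem one_star (x : W) : star K W (one K) x = x := by
  simp [star_apply, one_right', aug_one]

/-- The dendriform identities hold for all arguments, units included. -/
theorem left_left' (x y z : W) :
    left (K := K) (left (K := K) x y) z = left (K := K) x (star K W y z) := by
  obtain ⟨a, x, hx, rfl⟩ := decomp (K := K) x
  obtain ⟨b, y, hy, rfl⟩ := decomp (K := K) y
  obtain ⟨c, z, hz, rfl⟩ := decomp (K := K) z
  simp [star_apply, left_left, hx, hy, hz, left_one', one_right', aug_one, aug_left]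
  module

theorem right_left' (x y z : W) :
    left (K := K) (right (K := K) x y) z = right (K := K) x (left (K := K) y z) := by
  obtain ⟨a, x, hx, rfl⟩ := decomp (K := K) x
  obtain ⟨b, y, hy, rfl⟩ := decomp (K := K) y
  obtain ⟨c, z, hz, rfl⟩ := decomp (K := K) z
  simp [right_left, hx, hy, hz, left_one', one_right', aug_left, aug_right]

theorem right_right' (x y z : W) :
    right (K := K) x (right (K := K) y z) = right (K := K) (star K W x y) z := by
  obtain ⟨a, x, hx, rfl⟩ := decomp (K := K) x
  obtain ⟨b, y, hy, rfl⟩ := decomp (K := K) y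
  obtain ⟨c, z, hz, rfl⟩ := decomp (K := K) z
  simp [star_apply, right_right, hx, hy, hz, left_one', one_right', aug_one, aug_right]
  module

end Basic

/-! ### The tensor product of two unital dendriform algebras -/

section Tensor

variable {K : Type*} {W W' : Type*} [Field K] [AddCommGroup W] [Module K W]
  [AddCommGroup W'] [Module K W'] [UnitalDendriform K W] [UnitalDendriform K W']

/-- The augmentation of a tensor product. -/
def tAug : W ⊗[K] W' →ₗ[K] K :=
  LinearMap.mul' K K ∘ₗ TensorProduct.map (aug (K := K)) (aug (K := K))

/-- `(a ⊗ b) ≺ (c ⊗ d) = (a * c) ⊗ (b ≺ d)`, except that the undefined term `1 ≺ 1` is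
omitted and replaced: `(a ⊗ 1) ≺ (c ⊗ 1) = (a ≺ c) ⊗ 1`. -/
def tLeft : W ⊗[K] W' →ₗ[K] W ⊗[K] W' →ₗ[K] W ⊗[K] W' :=
  TensorProduct.map₂ (star K W) left + TensorProduct.map₂ left (augOne K W')

/-- `(a ⊗ b) ≻ (c ⊗ d) = (a * c) ⊗ (b ≻ d)`, except that the undefined term `1 ≻ 1` is
omitted and replaced: `(a ⊗ 1) ≻ (c ⊗ 1) = (a ≻ c) ⊗ 1`. -/
def tRight : W ⊗[K] W' →ₗ[K] W ⊗[K] W' →ₗ[K] W ⊗[K] W' :=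
  TensorProduct.map₂ (star K W) right + TensorProduct.map₂ right (augOne K W')

@[simp] theorem tAug_tmul (a : W) (b : W') :
    tAug (K := K) (a ⊗ₜ[K] b) = aug (K := K) a * aug (K := K) b := rfl

theorem tLeft_tmul (a c : W) (b d : W') : tLeft (K := K) (a ⊗ₜ[K] b) (c ⊗ₜ[K] d) =
    star K W a c ⊗ₜ[K] left (K := K) b d +
      left (K := K) a c ⊗ₜ[K] ((aug (K := K) b * aug (K := K) d) • one K) := rfl

theorem tRight_tmul (a c : W) (b d : W') : tRight (K := K) (a ⊗ₜ[K] b) (c ⊗ₜ[K] d) =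
    star K W a c ⊗ₜ[K] right (K := K) b d +
      right (K := K) a c ⊗ₜ[K] ((aug (K := K) b * aug (K := K) d) • one K) := rfl

theorem star_assoc (x y z : W) :
    star K W (star K W x y) z = star K W x (star K W y z) := by
  have h1 := left_left' (K := K) x y z
  have h2 := right_left' (K := K) x y z
  have h3 := right_right' (K := K) x y z
  have h4 : star K W (star K W x y) z = left (K := K) (left (K := K) x y) z +
      left (K := K) (right (K := K) x y) z + (aug (K := K) x * aug (K := K) y) •
        left (K := K) (one K) z + right (K := K) (star K W x y) z +
      (aug (K := K) x * aug (K := K) y * aug (K := K) z) • one K := by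
    rw [star_apply (star K W x y) z, aug_star]
    conv_lhs => enter [1, 1, 1]; rw [star_apply]
    simp
  have h5 : star K W x (star K W y z) = left (K := K) x (star K W y z) +
      right (K := K) x (left (K := K) y z) + right (K := K) x (right (K := K) y z)
      + (aug (K := K) y * aug (K := K) z) • right (K := K) x (one K) +
      (aug (K := K) x * aug (K := K) y * aug (K := K) z) • one K := by
    rw [star_apply x (star K W y z), aug_star]
    conv_lhs => enter [1, 2]; rw [star_apply]
    simp [mul_assoc, add_assoc]
  rw [h4, h5, h1, h2, h3]
  simp only [one_left', right_one', smul_zero]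
  abel

theorem tStar_tmul (a c : W) (b d : W') :
    tLeft (K := K) (a ⊗ₜ[K] b) (c ⊗ₜ[K] d) + tRight (K := K) (a ⊗ₜ[K] b) (c ⊗ₜ[K] d) +
      (tAug (K := K) (a ⊗ₜ[K] b) * tAug (K := K) (c ⊗ₜ[K] d)) • (one K ⊗ₜ[K] one K) =
    star K W a c ⊗ₜ[K] star K W' b d := by
  rw [tLeft_tmul, tRight_tmul, star_apply b d]
  simp only [TensorProduct.tmul_add, tAug_tmul]
  rw [star_apply a c]
  simp only [TensorProduct.add_tmul, TensorProduct.tmul_smul, ← TensorProduct.smul_tmul']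
  module

/-- The bilinear extension of `tStar_tmul`. -/
theorem tStar_eq : tLeft (K := K) (W := W) (W' := W') + tRight +
    LinearMap.mk₂ K (fun x y => (tAug (K := K) x * tAug (K := K) y) • (one K ⊗ₜ[K] one K))
    (by intros; simp [add_mul, add_smul]) (by intros; simp [mul_assoc, mul_smul])
    (by intros; simp [mul_add, add_smul]) (by intros; simp [mul_left_comm, mul_smul])
    = TensorProduct.map₂ (star K W) (star K W') := by
  refine TensorProduct.ext' fun a b => ?_
  refine TensorProduct.ext' fun c d => ?_
  simpa using tStar_tmul (K := K) a c b d

theorem tLeft_left (x y z : W ⊗[K] W') : tLeft (K := K) (tLeft (K := K) x y) z =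
    tLeft (K := K) x (TensorProduct.map₂ (star K W) (star K W') y z) := by
  induction x with
  | zero => simp
  | add x x' hx hx' => simp only [map_add, LinearMap.add_apply, hx, hx']
  | tmul a b =>
  induction y with
  | zero => simp
  | add y y' hy hy' => simp only [map_add, LinearMap.add_apply, hy, hy']
  | tmul c d =>
  induction z with
  | zero => simp
  | add z z' hz hz' => simp only [map_add, hz, hz']
  | tmul e f =>
    simp [tLeft_tmul, left_left', star_assoc, aug_left, aug_one, smul_smul, mul_assoc,
      TensorProduct.tmul_smul]

theorem tRight_left (x y z : W ⊗[K] W') : tLeft (K := K) (tRight (K := K) x y) z =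
    tRight (K := K) x (tLeft (K := K) y z) := by
  induction x with
  | zero => simp
  | add x x' hx hx' => simp only [map_add, LinearMap.add_apply, hx, hx']
  | tmul a b =>
  induction y with
  | zero => simp
  | add y y' hy hy' => simp only [map_add, LinearMap.add_apply, hy, hy']
  | tmul c d =>
  induction z with
  | zero => simp
  | add z z' hz hz' => simp only [map_add, hz, hz']
  | tmul e f =>
    simp [tLeft_tmul, tRight_tmul, right_left', star_assoc, aug_left, aug_right, aug_one,
      TensorProduct.tmul_smul, smul_smul, mul_comm, mul_left_comm]

theorem tRight_right (x y z : W ⊗[K] W') : tRight (K := K) x (tRight (K := K) y z) =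
    tRight (K := K) (TensorProduct.map₂ (star K W) (star K W') x y) z := by
  induction x with
  | zero => simp
  | add x x' hx hx' => simp only [map_add, LinearMap.add_apply, hx, hx']
  | tmul a b =>
  induction y with
  | zero => simp
  | add y y' hy hy' => simp only [map_add, LinearMap.add_apply, hy, hy']
  | tmul c d =>
  induction z with
  | zero => simp
  | add z z' hz hz' => simp only [map_add, hz, hz']
  | tmul e f =>
    simp [tRight_tmul, right_right', star_assoc, aug_right, aug_one, smul_smul,
      TensorProduct.tmul_smul, mul_comm, mul_left_comm]

theorem tAug_tLeft (x y : W ⊗[K] W') : tAug (K := K) (tLeft (K := K) x y) = 0 := by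
  induction x with
  | zero => simp
  | add x x' hx hx' => simp only [map_add, LinearMap.add_apply, hx, hx', add_zero]
  | tmul a b =>
  induction y with
  | zero => simp
  | add y y' hy hy' => simp only [map_add, hy, hy', add_zero]
  | tmul c d => simp [tLeft_tmul, aug_left]

theorem tAug_tRight (x y : W ⊗[K] W') : tAug (K := K) (tRight (K := K) x y) = 0 := by
  induction x with
  | zero => simp
  | add x x' hx hx' => simp only [map_add, LinearMap.add_apply, hx, hx', add_zero]
  | tmul a b =>
  induction y with
  | zero => simp
  | add y y' hy hy' => simp only [map_add, hy, hy', add_zero]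
  | tmul c d => simp [tRight_tmul, aug_right]

theorem tLeft_one (x : W ⊗[K] W') : tLeft (K := K) x (one K ⊗ₜ[K] one K) =
    x - tAug (K := K) x • (one K ⊗ₜ[K] one K) := by
  induction x with
  | zero => simp
  | add x x' hx hx' =>
    simp only [map_add, LinearMap.add_apply, hx, hx', add_smul]
    abel
  | tmul a b =>
    simp only [tLeft_tmul, star_one, left_one', aug_one, mul_one, tAug_tmul,
      TensorProduct.tmul_sub, TensorProduct.sub_tmul, TensorProduct.tmul_smul,
      ← TensorProduct.smul_tmul']
    module

theorem one_tRight (x : W ⊗[K] W') : tRight (K := K) (one K ⊗ₜ[K] one K) x =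
    x - tAug (K := K) x • (one K ⊗ₜ[K] one K) := by
  induction x with
  | zero => simp
  | add x x' hx hx' =>
    simp only [map_add, hx, hx', add_smul]
    abel
  | tmul a b =>
    simp only [tRight_tmul, one_star, one_right', aug_one, one_mul, tAug_tmul,
      TensorProduct.tmul_sub, TensorProduct.sub_tmul, TensorProduct.tmul_smul,
      ← TensorProduct.smul_tmul']
    module

theorem one_tLeft (x : W ⊗[K] W') : tLeft (K := K) (one K ⊗ₜ[K] one K) x = 0 := by
  induction x with
  | zero => simp
  | add x x' hx hx' => simp only [map_add, hx, hx', add_zero]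
  | tmul a b => simp [tLeft_tmul]

theorem tRight_one (x : W ⊗[K] W') : tRight (K := K) x (one K ⊗ₜ[K] one K) = 0 := by
  induction x with
  | zero => simp
  | add x x' hx hx' => simp only [map_add, LinearMap.add_apply, hx, hx', add_zero]
  | tmul a b => simp [tRight_tmul]

theorem tStar_of_aug {x y : W ⊗[K] W'} (hx : tAug (K := K) x = 0) :
    TensorProduct.map₂ (star K W) (star K W') x y = tLeft (K := K) x y + tRight (K := K) x y := by
  rw [← tStar_eq]
  simp [hx]

/-- The tensor product of unital dendriform algebras. A coproduct `Δ : W → W ⊗ W` with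
`Δ 1 = 1 ⊗ 1` and counit `aug` satisfies the two compatibility relations of a dendriform bialgebra
exactly when it is multiplicative for these products. -/
instance instTensor : UnitalDendriform K (W ⊗[K] W') where
  one := one K ⊗ₜ[K] one K
  aug := tAug
  left := tLeft
  right := tRight
  aug_one := by simp [aug_one]
  aug_left := tAug_tLeft
  aug_right := tAug_tRight
  left_left x y z _ hy _ := by rw [tLeft_left, tStar_of_aug hy, map_add]
  right_left x y z _ _ _ := tRight_left x y z
  right_right x y z hx _ _ := by
    rw [tRight_right, tStar_of_aug hx, map_add, LinearMap.add_apply, add_comm]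
  one_left x _ := one_tLeft x
  right_one x _ := tRight_one x
  left_one x hx := by rw [tLeft_one, hx, zero_smul, sub_zero]
  one_right x hx := by rw [one_tRight, hx, zero_smul, sub_zero]
  one_left_one := one_tLeft _
  one_right_one := tRight_one _

theorem one_tensor : (one K : W ⊗[K] W') = one K ⊗ₜ[K] one K := rfl

theorem aug_tmul (a : W) (b : W') :
    aug (K := K) (a ⊗ₜ[K] b) = aug (K := K) a * aug (K := K) b := rfl

theorem left_tmul (a c : W) (b d : W') : left (K := K) (a ⊗ₜ[K] b) (c ⊗ₜ[K] d) =
    star K W a c ⊗ₜ[K] left (K := K) b d +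
      left (K := K) a c ⊗ₜ[K] ((aug (K := K) b * aug (K := K) d) • one K) := rfl

theorem right_tmul (a c : W) (b d : W') : right (K := K) (a ⊗ₜ[K] b) (c ⊗ₜ[K] d) =
    star K W a c ⊗ₜ[K] right (K := K) b d +
      right (K := K) a c ⊗ₜ[K] ((aug (K := K) b * aug (K := K) d) • one K) := rfl

end Tensor

end UnitalDendriform

/-- Morphisms of unital dendriform algebras: linear maps respecting the decompositions
`K·1 ⊕ V` and the unit, and restricting to a morphism of dendriform algebras on `V`. -/
structure IsUDendHom {K W W' : Type*} [Field K] [AddCommGroup W] [Module K W]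
    [AddCommGroup W'] [Module K W'] [UnitalDendriform K W] [UnitalDendriform K W']
    (f : W →ₗ[K] W') : Prop where
  map_one : f (UnitalDendriform.one K) = UnitalDendriform.one K
  map_plus : ∀ x, UnitalDendriform.aug (K := K) x = 0 → UnitalDendriform.aug (K := K) (f x) = 0
  map_left : ∀ x y, UnitalDendriform.aug (K := K) x = 0 → UnitalDendriform.aug (K := K) y = 0 →
    f (UnitalDendriform.left (K := K) x y) = UnitalDendriform.left (K := K) (f x) (f y)
  map_right : ∀ x y, UnitalDendriform.aug (K := K) x = 0 → UnitalDendriform.aug (K := K) y = 0 →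
    f (UnitalDendriform.right (K := K) x y) = UnitalDendriform.right (K := K) (f x) (f y)

namespace IsUDendHom

open UnitalDendriform

variable {K W W' W₁ W₁' W₂ : Type*} [Field K] [AddCommGroup W] [Module K W]
    [AddCommGroup W'] [Module K W'] [AddCommGroup W₁] [Module K W₁]
    [AddCommGroup W₁'] [Module K W₁'] [AddCommGroup W₂] [Module K W₂]
    [UnitalDendriform K W] [UnitalDendriform K W'] [UnitalDendriform K W₁]
    [UnitalDendriform K W₁'] [UnitalDendriform K W₂]
    {f : W →ₗ[K] W'} {g : W₁ →ₗ[K] W₁'}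

theorem map_aug (hf : IsUDendHom f) (x : W) : aug (K := K) (f x) = aug (K := K) x := by
  obtain ⟨c, x, hx, rfl⟩ := decomp (K := K) x
  simp [hf.map_one, hf.map_plus x hx, hx, aug_one]

theorem map_left' (hf : IsUDendHom f) (x y : W) :
    f (left (K := K) x y) = left (K := K) (f x) (f y) := by
  obtain ⟨a, x, hx, rfl⟩ := decomp (K := K) x
  obtain ⟨b, y, hy, rfl⟩ := decomp (K := K) y
  simp [hf.map_one, hf.map_left x y hx hy, hx, left_one', hf.map_aug]

theorem map_right' (hf : IsUDendHom f) (x y : W) :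
    f (right (K := K) x y) = right (K := K) (f x) (f y) := by
  obtain ⟨a, x, hx, rfl⟩ := decomp (K := K) x
  obtain ⟨b, y, hy, rfl⟩ := decomp (K := K) y
  simp [hf.map_one, hf.map_right x y hx hy, hy, one_right', hf.map_aug, aug_one]

theorem map_star (hf : IsUDendHom f) (x y : W) :
    f (star K W x y) = star K W' (f x) (f y) := by
  simp [star_apply, hf.map_one, hf.map_left', hf.map_right', hf.map_aug]

theorem of_total (h1 : f (one K) = one K) (ha : ∀ x, aug (K := K) (f x) = aug (K := K) x)
    (hl : ∀ x y, f (left (K := K) x y) = left (K := K) (f x) (f y))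
    (hr : ∀ x y, f (right (K := K) x y) = right (K := K) (f x) (f y)) : IsUDendHom f :=
  ⟨h1, fun x hx => (ha x).trans hx, fun x y _ _ => hl x y, fun x y _ _ => hr x y⟩

theorem comp {h : W' →ₗ[K] W₁} (hh : IsUDendHom h) (hf : IsUDendHom f) :
    IsUDendHom (h ∘ₗ f) :=
  of_total (by simp [hf.map_one, hh.map_one]) (by simp [hf.map_aug, hh.map_aug])
    (by simp [hf.map_left', hh.map_left']) (by simp [hf.map_right', hh.map_right'])

theorem id : IsUDendHom (LinearMap.id : W →ₗ[K] W) :=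
  of_total rfl (fun _ => rfl) (fun _ _ => rfl) (fun _ _ => rfl)

/-- Checking multiplicativity on a tensor product on pure tensors. -/
theorem of_tmul {f : W ⊗[K] W₁ →ₗ[K] W₂} (h1 : f (one K ⊗ₜ one K) = one K)
    (ha : ∀ a b, aug (K := K) (f (a ⊗ₜ b)) = aug (K := K) a * aug (K := K) b)
    (hl : ∀ a b c d, f (left (K := K) (a ⊗ₜ[K] b) (c ⊗ₜ[K] d)) =
      left (K := K) (f (a ⊗ₜ b)) (f (c ⊗ₜ d)))
    (hr : ∀ a b c d, f (right (K := K) (a ⊗ₜ[K] b) (c ⊗ₜ[K] d)) =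
      right (K := K) (f (a ⊗ₜ b)) (f (c ⊗ₜ d))) : IsUDendHom f := by
  refine of_total h1 (fun x => ?_) (fun x y => ?_) (fun x y => ?_)
  · induction x with
    | zero => simp
    | add x x' hx hx' => simp only [map_add, hx, hx']
    | tmul a b => exact ha a b
  · induction x with
    | zero => simp
    | add x x' hx hx' => simp only [map_add, LinearMap.add_apply, hx, hx']
    | tmul a b =>
    induction y with
    | zero => simp
    | add y y' hy hy' => simp only [map_add, hy, hy']
    | tmul c d => exact hl a b c d
  · induction x with
    | zero => simp
    | add x x' hx hx' => simp only [map_add, LinearMap.add_apply, hx, hx']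
    | tmul a b =>
    induction y with
    | zero => simp
    | add y y' hy hy' => simp only [map_add, hy, hy']
    | tmul c d => exact hr a b c d

theorem tensor (hf : IsUDendHom f) (hg : IsUDendHom g) : IsUDendHom (TensorProduct.map f g) := by
  refine of_tmul ?_ (fun a b => ?_) (fun a b c d => ?_) (fun a b c d => ?_)
  · simp [hf.map_one, hg.map_one, one_tensor]
  · simp [hf.map_aug, hg.map_aug, aug_tmul]
  · simp [left_tmul, hf.map_star, hg.map_left', hf.map_left', hg.map_aug, hg.map_one]
  · simp [right_tmul, hf.map_star, hg.map_right', hf.map_right', hg.map_aug, hg.map_one]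

theorem star_tmul (a c : W) (b d : W₁) : star K (W ⊗[K] W₁) (a ⊗ₜ[K] b) (c ⊗ₜ[K] d) =
    star K W a c ⊗ₜ[K] star K W₁ b d := tStar_tmul a c b d

theorem assoc : IsUDendHom (TensorProduct.assoc K W W₁ W₂).toLinearMap := by
  refine of_tmul rfl (fun a c => ?_) (fun a c a' c' => ?_) (fun a c a' c' => ?_)
  · induction a with
    | zero => simp
    | add x x' hx hx' =>
      simp only [map_add, TensorProduct.add_tmul, hx, hx', add_mul]
    | tmul a b => simp [aug_tmul, mul_assoc]
  · induction a with
    | zero => simp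
    | add x x' hx hx' => simp only [map_add, TensorProduct.add_tmul, LinearMap.add_apply, hx, hx']
    | tmul a b =>
    induction a' with
    | zero => simp
    | add x x' hx hx' => simp only [map_add, TensorProduct.add_tmul, hx, hx']
    | tmul a' b' =>
      simp [left_tmul, star_tmul, one_tensor, aug_tmul, TensorProduct.add_tmul,
        TensorProduct.tmul_add, TensorProduct.tmul_smul, ← TensorProduct.smul_tmul', smul_smul, mul_comm,
        mul_left_comm, mul_assoc, add_assoc]
  · induction a with
    | zero => simp
    | add x x' hx hx' => simp only [map_add, TensorProduct.add_tmul, LinearMap.add_apply, hx, hx']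
    | tmul a b =>
    induction a' with
    | zero => simp
    | add x x' hx hx' => simp only [map_add, TensorProduct.add_tmul, hx, hx']
    | tmul a' b' =>
      simp [right_tmul, star_tmul, one_tensor, aug_tmul, TensorProduct.add_tmul,
        TensorProduct.tmul_add, TensorProduct.tmul_smul, ← TensorProduct.smul_tmul', smul_smul, mul_comm,
        mul_left_comm, mul_assoc, add_assoc]

theorem lid : IsUDendHom
    ((TensorProduct.lid K W).toLinearMap ∘ₗ (aug (K := K) (W := W₁)).rTensor W) := by
  refine of_tmul ?_ (fun a c => ?_) (fun a c a' c' => ?_) (fun a c a' c' => ?_)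
  · simp [aug_one]
  · simp
  · simp [left_tmul, aug_left, smul_smul, mul_comm]
  · simp [right_tmul, aug_right, smul_smul, mul_comm]

theorem rid : IsUDendHom
    ((TensorProduct.rid K W).toLinearMap ∘ₗ (aug (K := K) (W := W₁)).lTensor W) := by
  refine of_tmul ?_ (fun a c => ?_) (fun a c a' c' => ?_) (fun a c a' c' => ?_)
  · simp [aug_one]
  · simp [mul_comm]
  · simp [left_tmul, aug_left, aug_one, smul_smul, mul_comm]
  · simp [right_tmul, aug_right, aug_one, smul_smul, mul_comm]

end IsUDendHom

/-! ### Adjoining a unit -/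

/-- The vector space `K·1 ⊕ D`. -/
def Uni (K : Type*) (D : Type*) : Type _ := K × D

namespace Uni

variable (K : Type*) {D : Type*} [Field K] [AddCommGroup D] [Module K D]

instance instAddCommGroup : AddCommGroup (Uni K D) := inferInstanceAs (AddCommGroup (K × D))

instance instModule : Module K (Uni K D) := inferInstanceAs (Module K (K × D))

/-- The inclusion `D → K·1 ⊕ D`. -/
def inc : D →ₗ[K] Uni K D := LinearMap.inr K K D

/-- The projection `K·1 ⊕ D → D`. -/
def proj : Uni K D →ₗ[K] D := LinearMap.snd K K D

/-- The projection `K·1 ⊕ D → K`. -/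
def scal : Uni K D →ₗ[K] K := LinearMap.fst K K D

@[simp] theorem proj_inc (x : D) : proj K (inc K x) = x := rfl

@[simp] theorem scal_inc (x : D) : scal K (inc K x) = 0 := rfl

/-- The unit of `K·1 ⊕ D`. -/
def unit : Uni K D := ((1 : K), (0 : D))

@[simp] theorem scal_unit : scal K (unit K : Uni K D) = 1 := rfl

@[simp] theorem proj_unit : proj K (unit K : Uni K D) = 0 := rfl

theorem inc_proj {x : Uni K D} (h : scal K x = 0) : inc K (proj K x) = x := Prod.ext h.symm rfl

/-- The unital dendriform algebra `K·1 ⊕ D` of a dendriform algebra `D`: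
`x ≺ 1 = 1 ≻ x = x` and `1 ≺ x = x ≻ 1 = 0` for `x` in `D`. -/
instance instUnital [Dendriform K D] : UnitalDendriform K (Uni K D) where
  one := unit K
  aug := scal K
  left := LinearMap.mk₂ K (fun x y => inc K (scal K y • proj K x +
      Dendriform.left (K := K) (proj K x) (proj K y)))
    (by
      intros
      simp only [map_add, map_smul, LinearMap.add_apply]
      module)
    (by
      intros
      simp only [map_add, map_smul, LinearMap.smul_apply]
      module)
    (by
      intros
      simp only [map_add, map_smul]
      module)
    (by
      intros
      simp only [map_add, map_smul, smul_eq_mul]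
      module)
  right := LinearMap.mk₂ K (fun x y => inc K (scal K x • proj K y +
      Dendriform.right (K := K) (proj K x) (proj K y)))
    (by
      intros
      simp only [map_add, map_smul, LinearMap.add_apply]
      module)
    (by
      intros
      simp only [map_add, map_smul, LinearMap.smul_apply, smul_eq_mul]
      module)
    (by
      intros
      simp only [map_add, map_smul]
      module)
    (by
      intros
      simp only [map_add, map_smul]
      module)
  aug_one := rfl
  aug_left _ _ := rfl
  aug_right _ _ := rfl
  left_left x y z hx hy hz := by simp [hy, hz, Dendriform.left_left]
  right_left x y z hx hy hz := by simp [hx, hz, Dendriform.right_left]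
  right_right x y z hx hy hz := by simp [hx, hy, Dendriform.right_right]
  one_left x hx := by simp [hx]
  right_one x hx := by simp [hx]
  left_one x hx := by simp [inc_proj K hx]
  one_right x hx := by simp [inc_proj K hx]
  one_left_one := by simp
  one_right_one := by simp

/-- Unital extension of a linear map defined on `D`. -/
def extend {W : Type*} [AddCommGroup W] [Module K W] [UnitalDendriform K W] (g : D →ₗ[K] W) :
    Uni K D →ₗ[K] W :=
  (scal K).smulRight (UnitalDendriform.one K) + g ∘ₗ proj K

theorem extend_one [Dendriform K D] {W : Type*} [AddCommGroup W] [Module K W] [UnitalDendriform K W]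
    (g : D →ₗ[K] W) : extend K g (UnitalDendriform.one K) = UnitalDendriform.one K := by
  change (1 : K) • _ + g 0 = _
  simp

theorem extend_inc {W : Type*} [AddCommGroup W] [Module K W] [UnitalDendriform K W]
    (g : D →ₗ[K] W) (x : D) : extend K g (inc K x) = g x := by
  simp [extend]

section

variable [Dendriform K D]

theorem aug_inc (x : D) : UnitalDendriform.aug (K := K) (inc K x) = 0 := rfl

theorem left_inc (x y : D) : UnitalDendriform.left (K := K) (inc K x) (inc K y) =
    inc K (Dendriform.left (K := K) x y) := by
  change inc K ((0 : K) • x + Dendriform.left (K := K) x y) = _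
  rw [zero_smul, zero_add]

theorem right_inc (x y : D) : UnitalDendriform.right (K := K) (inc K x) (inc K y) =
    inc K (Dendriform.right (K := K) x y) := by
  change inc K ((0 : K) • y + Dendriform.right (K := K) x y) = _
  rw [zero_smul, zero_add]

theorem eq_one_add_inc (x : Uni K D) :
    x = scal K x • (UnitalDendriform.one K : Uni K D) + inc K (proj K x) := by
  refine Prod.ext ?_ ?_
  · change scal K x = scal K x * 1 + 0
    simp
  · change proj K x = scal K x • (0 : D) + proj K x
    simp

theorem isUDendHom_extend {W : Type*} [AddCommGroup W] [Module K W] [UnitalDendriform K W]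
    {g : D →ₗ[K] W} (ha : ∀ x, UnitalDendriform.aug (K := K) (g x) = 0)
    (hl : ∀ x y, g (Dendriform.left (K := K) x y) = UnitalDendriform.left (K := K) (g x) (g y))
    (hr : ∀ x y, g (Dendriform.right (K := K) x y) = UnitalDendriform.right (K := K) (g x) (g y)) :
    IsUDendHom (extend K g) where
  map_one := extend_one K g
  map_plus x hx := by
    rw [← inc_proj K hx, extend_inc, ha]
  map_left x y hx hy := by
    rw [← inc_proj K hx, ← inc_proj K hy, left_inc, extend_inc, extend_inc, extend_inc, hl]
  map_right x y hx hy := by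
    rw [← inc_proj K hx, ← inc_proj K hy, right_inc, extend_inc, extend_inc, extend_inc, hr]

end

end Uni

/-! ### Brace algebras -/

/-- All lists `Y₀, {x₁ | Y₁}, Y₂, {x₂ | Y₃}, …, {xₙ | Y₂ₙ₋₁}, Y₂ₙ` where `Y₀, …, Y₂ₙ` runs over the
decompositions of the list `ys` into successive, possibly empty, intervals. In the recursion
`Y₀` consists of the first `i` letters and `Y₁` of the `j` letters after them. -/
def insertions {B : Type*} (brace : B → List B → B) : List B → List B → List (List B)
  | [], ys => [ys]
  | x :: xs, ys => (List.range (ys.length + 1)).flatMap fun i =>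
      (List.range (ys.length - i + 1)).flatMap fun j =>
        (insertions brace xs (ys.drop (i + j))).map fun t =>
          ys.take i ++ brace x ((ys.drop i).take j) :: t

/-- A brace algebra: a vector space with multilinear operations `{x | y₁, …, yₙ}`, written
`brace x [y₁, …, yₙ]`, subject to the brace relations, with the convention `{x | } = x`. -/
class BraceAlgebra (K : Type*) (B : Type*) [Field K] [AddCommGroup B] [Module K B] where
  brace : B → List B → B
  brace_nil : ∀ x, brace x [] = x
  brace_add_root : ∀ x x' ys, brace (x + x') ys = brace x ys + brace x' ys
  brace_smul_root : ∀ (c : K) x ys, brace (c • x) ys = c • brace x ys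
  brace_add_leaf : ∀ x l y y' r, brace x (l ++ (y + y') :: r) =
    brace x (l ++ y :: r) + brace x (l ++ y' :: r)
  brace_smul_leaf : ∀ (c : K) x l y r, brace x (l ++ (c • y) :: r) = c • brace x (l ++ y :: r)
  brace_brace : ∀ z xs ys, brace (brace z xs) ys =
    ((insertions brace xs ys).map (brace z)).sum

/-- A brace algebra is trivial if all its brace products `{x | y₁, …, yₙ}`, `n ≥ 1`, vanish. -/
def BraceAlgebra.IsTrivial (K : Type*) (B : Type*) [Field K] [AddCommGroup B] [Module K B]
    [BraceAlgebra K B] : Prop :=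
  ∀ (x : B) (ys : List B), ys ≠ [] → brace K x ys = 0

/-! ### The brace operations of a dendriform algebra -/

section Corolla

open UnitalDendriform

variable (K : Type*) {W : Type*} [Field K] [AddCommGroup W] [Module K W] [UnitalDendriform K W]

/-- `x₁ ≺ (x₂ ≺ (… ≺ xₙ))`, equal to `1` for the empty list. -/
def nearrow : List W → W
  | [] => one K
  | x :: l => left (K := K) x (nearrow l)

/-- `((x₁ ≻ x₂) ≻ …) ≻ xₙ`, equal to `1` for the empty list. -/
def searrow (l : List W) : W := l.foldl (fun a x => right (K := K) a x) (one K)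

/-- The value on elements of `V` of the operation attached to a corolla with root `x` and leaves
`y₁, …, yₙ`:
`∑ (-1)ⁱ (y₁ ≺ (… ≺ yᵢ)) ≻ x ≺ ((yᵢ₊₁ ≻ …) ≻ yₙ)`, the sum being over `0 ≤ i ≤ n`. -/
def corolla (x : W) (ys : List W) : W :=
  ∑ i ∈ Finset.range (ys.length + 1), (-1 : K) ^ i •
    left (K := K) (right (K := K) (nearrow K (ys.take i)) x) (searrow K (ys.drop i))

/-- The sum of `f p q` over all ways to cut a list in two pieces `p`, `q`. -/
def cutSum {A M : Type*} [AddCommMonoid M] : (List A → List A → M) → List A → M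
  | f, [] => f [] []
  | f, x :: l => f [] (x :: l) + cutSum (fun p q => f (x :: p) q) l

section CutSum

variable {A M N : Type*} [AddCommMonoid M]

theorem cutSum_eq (f : List A → List A → M) (l : List A) :
    cutSum f l = ∑ i ∈ Finset.range (l.length + 1), f (l.take i) (l.drop i) := by
  induction l generalizing f with
  | nil => simp [cutSum]
  | cons x l ih =>
    rw [cutSum, ih, List.length_cons, Finset.sum_range_succ' _ (l.length + 1), add_comm]
    simp

theorem cutSum_congr {f g : List A → List A → M} (l : List A)
    (h : ∀ p q, l = p ++ q → f p q = g p q) : cutSum f l = cutSum g l := by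
  rw [cutSum_eq, cutSum_eq]
  exact Finset.sum_congr rfl fun i _ => h _ _ (List.take_append_drop i l).symm

theorem cutSum_add (f g : List A → List A → M) (l : List A) :
    cutSum (fun p q => f p q + g p q) l = cutSum f l + cutSum g l := by
  simp [cutSum_eq, Finset.sum_add_distrib]

theorem map_cutSum [AddCommMonoid N] {F : Type*} [FunLike F M N] [AddMonoidHomClass F M N]
    (φ : F) (f : List A → List A → M) (l : List A) :
    φ (cutSum f l) = cutSum (fun p q => φ (f p q)) l := by
  simp [cutSum_eq]

theorem cutSum_map {A' : Type*} (g : A' → A) (f : List A → List A → M) (l : List A') :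
    cutSum f (l.map g) = cutSum (fun p q => f (p.map g) (q.map g)) l := by
  simp [cutSum_eq]

theorem cutSum_append_singleton (f : List A → List A → M) (l : List A) (x : A) :
    cutSum f (l ++ [x]) = cutSum (fun p q => f p (q ++ [x])) l + f (l ++ [x]) [] := by
  induction l generalizing f with
  | nil => simp [cutSum]
  | cons y l ih => simp [cutSum, ih, add_assoc]

theorem cutSum_left_nil (f : List A → List A → M) (l : List A)
    (h : ∀ x p q, f (x :: p) q = 0) : cutSum f l = f [] l := by
  cases l with
  | nil => rfl
  | cons x l => simp [cutSum, h, cutSum_eq]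

theorem cutSum_right_nil (f : List A → List A → M) (l : List A)
    (h : ∀ p q x, f p (q ++ [x]) = 0) : cutSum f l = f l [] := by
  rcases List.eq_nil_or_concat l with rfl | ⟨l, x, rfl⟩
  · rfl
  · rw [List.concat_eq_append, cutSum_append_singleton]
    simp [h, cutSum_eq]

theorem cutSum_assoc (G : List A → List A → List A → M) (l : List A) :
    cutSum (fun p q => cutSum (fun a b => G a b q) p) l =
      cutSum (fun a m => cutSum (fun b q => G a b q) m) l := by
  induction l generalizing G with
  | nil => rfl
  | cons x l ih =>
    simp only [cutSum]
    rw [cutSum_add, ih, add_assoc]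

end CutSum

variable {K}

theorem corolla_eq (x : W) (ys : List W) : corolla K x ys = cutSum (fun p q =>
    (-1 : K) ^ p.length • left (K := K) (right (K := K) (nearrow K p) x) (searrow K q)) ys := by
  rw [cutSum_eq, corolla]
  refine Finset.sum_congr rfl fun i hi => ?_
  rw [List.length_take, min_eq_left (by simp at hi; omega)]

@[simp] theorem nearrow_nil : nearrow K ([] : List W) = one K := rfl

@[simp] theorem nearrow_cons (x : W) (l : List W) :
    nearrow K (x :: l) = left (K := K) x (nearrow K l) := rfl

@[simp] theorem searrow_nil : searrow K ([] : List W) = one K := rfl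

@[simp] theorem searrow_append (l : List W) (x : W) :
    searrow K (l ++ [x]) = right (K := K) (searrow K l) x := by
  simp [searrow]

theorem aug_corolla (x : W) (ys : List W) : aug (K := K) (corolla K x ys) = 0 := by
  simp [corolla, aug_left]

/-- The primitive element `x ⊗ 1 + 1 ⊗ x`. -/
def primitive : W →ₗ[K] W ⊗[K] W :=
  (TensorProduct.mk K W W).flip (one K) + TensorProduct.mk K W W (one K)

theorem primitive_apply (x : W) :
    primitive (K := K) x = x ⊗ₜ[K] one K + one K ⊗ₜ[K] x := rfl

theorem aug_primitive {x : W} (hx : aug (K := K) x = 0) : aug (K := K) (primitive (K := K) x) = 0 := by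
  simp [primitive_apply, aug_tmul, hx]

theorem left_primitive {x : W} (hx : aug (K := K) x = 0) (p q : W) :
    left (K := K) (primitive (K := K) x) (p ⊗ₜ[K] q) =
      aug (K := K) q • (left (K := K) x p ⊗ₜ[K] one K) + p ⊗ₜ[K] left (K := K) x q := by
  simp [primitive_apply, left_tmul, hx, aug_one]

theorem right_primitive {x : W} (hx : aug (K := K) x = 0) (p q : W) :
    right (K := K) (p ⊗ₜ[K] q) (primitive (K := K) x) =
      aug (K := K) q • (right (K := K) p x ⊗ₜ[K] one K) + p ⊗ₜ[K] right (K := K) q x := by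
  simp [primitive_apply, right_tmul, hx, aug_one]

theorem nearrow_primitive (l : List W) (hl : ∀ x ∈ l, aug (K := K) x = 0) :
    nearrow K (l.map (primitive (K := K))) =
      cutSum (fun p q => nearrow K q ⊗ₜ[K] nearrow K p) l := by
  induction l with
  | nil => rfl
  | cons x l ih =>
    have hx := hl x (by simp)
    rw [List.map_cons, nearrow_cons, ih fun y hy => hl y (by simp [hy]), map_cutSum, cutSum]
    simp only [left_primitive hx]
    rw [cutSum_add, cutSum_left_nil (fun p q => aug (K := K) (nearrow K p) •
      (left (K := K) x (nearrow K q) ⊗ₜ[K] one K)) l (by intros; simp [aug_left])]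
    simp [aug_one]

theorem searrow_primitive (l : List W) (hl : ∀ x ∈ l, aug (K := K) x = 0) :
    searrow K (l.map (primitive (K := K))) =
      cutSum (fun p q => searrow K p ⊗ₜ[K] searrow K q) l := by
  induction l using List.reverseRecOn with
  | nil => rfl
  | append_singleton l x ih =>
    have hx := hl x (by simp)
    rw [List.map_append, List.map_singleton, searrow_append, ih fun y hy => hl y (by simp [hy]),
      ← LinearMap.flip_apply, map_cutSum, cutSum_append_singleton]
    simp only [LinearMap.flip_apply, right_primitive hx]
    rw [cutSum_add, cutSum_right_nil (fun p q => aug (K := K) (searrow K q) •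
      (right (K := K) (searrow K p) x ⊗ₜ[K] one K)) l (by intros; simp [aug_right])]
    simp [aug_one, add_comm]

/-- The alternating sum `∑ (-1)ⁱ (y₁ ≺ (… ≺ yᵢ)) * ((yᵢ₊₁ ≻ …) ≻ yₙ)`. -/
def alt (l : List W) : W :=
  cutSum (fun p q => (-1 : K) ^ p.length • star K W (nearrow K p) (searrow K q)) l

theorem alt_eq (l : List W) (h : l ≠ []) : alt (K := K) l =
    cutSum (fun p q => (-1 : K) ^ p.length • left (K := K) (nearrow K p) (searrow K q)) l +
    cutSum (fun p q => (-1 : K) ^ p.length • right (K := K) (nearrow K p) (searrow K q)) l := by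
  rw [alt, ← cutSum_add]
  refine cutSum_congr l fun p q hpq => ?_
  have : aug (K := K) (nearrow K p) * aug (K := K) (searrow K q) = 0 := by
    cases p with
    | cons x p => simp [aug_left]
    | nil =>
      rcases List.eq_nil_or_concat q with rfl | ⟨q, x, rfl⟩
      · simp_all
      · simp [aug_right]
  rw [star_apply, this, zero_smul, add_zero, smul_add]

theorem alt_left (x : W) (l : List W) :
    cutSum (fun p q => (-1 : K) ^ p.length • left (K := K) (nearrow K p) (searrow K q)) (x :: l) =
      - left (K := K) x (alt (K := K) l) := by
  rw [cutSum, alt, ← LinearMap.neg_apply, ← map_neg, map_cutSum]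
  simp [pow_succ, left_left']

theorem alt_right (l : List W) (x : W) :
    cutSum (fun p q => (-1 : K) ^ p.length • right (K := K) (nearrow K p) (searrow K q))
      (l ++ [x]) = right (K := K) (alt (K := K) l) x := by
  have := map_cutSum ((right (K := K)).flip x) (fun p q : List W =>
    (-1 : K) ^ p.length • star K W (nearrow K p) (searrow K q)) l
  simp only [LinearMap.flip_apply] at this
  rw [cutSum_append_singleton, alt, this]
  simp [right_right']

theorem alt_eq_zero (l : List W) (h : l ≠ []) (hl : ∀ x ∈ l, aug (K := K) x = 0) :
    alt (K := K) l = 0 := by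
  induction hn : l.length using Nat.strong_induction_on generalizing l with
  | _ n ih =>
  match l, h, hl, hn with
  | [x], _, hl, _ =>
    have hx := hl x (by simp)
    simp [alt, cutSum, searrow, one_right', left_one', hx]
  | x :: y :: l, h, hl, hn =>
    rw [alt_eq _ h, alt_left, ih (l.length + 1) (by simp at hn; omega) (y :: l) (by simp)
      (fun z hz => hl z (by simp_all)) (by simp)]
    rcases List.eq_nil_or_concat (y :: l) with h' | ⟨m, z, h'⟩
    · simp at h'
    · rw [List.concat_eq_append] at h'
      rw [h', ← List.cons_append, alt_right, ih (m.length + 1)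
        (by have := congrArg List.length h'; simp at this hn; omega) (x :: m) (by simp)
        (fun w hw => hl w ?_) (by simp)]
      · simp
      · rw [h', ← List.cons_append]
        exact List.mem_append_left _ hw

/-- The brace operations preserve primitive elements. -/
theorem corolla_primitive (x : W) (l : List W) (hx : aug (K := K) x = 0)
    (hl : ∀ y ∈ l, aug (K := K) y = 0) :
    corolla K (primitive (K := K) x) (l.map (primitive (K := K))) =
      primitive (K := K) (corolla K x l) := by
  rw [corolla_eq, cutSum_map]
  have step : ∀ p q, l = p ++ q →
      (-1 : K) ^ (p.map (primitive (K := K))).length • left (K := K)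
        (right (K := K) (nearrow K (p.map (primitive (K := K)))) (primitive (K := K) x))
        (searrow K (q.map (primitive (K := K)))) =
      (-1 : K) ^ p.length • (left (K := K) (right (K := K) (nearrow K p) x) (searrow K q) ⊗ₜ[K] one K)
      + cutSum (fun a b => cutSum (fun c d => (-1 : K) ^ (a.length + b.length) •
        (star K W (nearrow K b) (searrow K c) ⊗ₜ[K]
          left (K := K) (right (K := K) (nearrow K a) x) (searrow K d))) q) p := by
    intro p q hpq
    have hp : ∀ y ∈ p, aug (K := K) y = 0 := fun y hy => hl y (by simp [hpq, hy])
    have hq : ∀ y ∈ q, aug (K := K) y = 0 := fun y hy => hl y (by simp [hpq, hy])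
    rw [List.length_map, nearrow_primitive p hp, searrow_primitive q hq,
      ← LinearMap.flip_apply (right (K := K)),
      map_cutSum ((right (K := K)).flip (primitive (K := K) x))]
    simp only [LinearMap.flip_apply, right_primitive hx]
    rw [cutSum_add, cutSum_left_nil (fun a b => aug (K := K) (nearrow K a) •
      (right (K := K) (nearrow K b) x ⊗ₜ[K] one K)) p (by intros; simp [aug_left]),
      map_add, LinearMap.add_apply, smul_add]
    congr 1
    · rw [map_cutSum, cutSum_right_nil]
      · simp [left_tmul, aug_one]
      · intros
        simp [left_tmul, aug_right]
    · rw [← LinearMap.flip_apply (left (K := K)), map_cutSum ((left (K := K)).flip _),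
        ← LinearMap.lsmul_apply (R := K), map_cutSum]
      refine cutSum_congr p fun a b hab => ?_
      rw [LinearMap.flip_apply, map_cutSum, map_cutSum]
      refine cutSum_congr q fun c d _ => ?_
      simp [left_tmul, aug_right, hab]
  rw [cutSum_congr l step, cutSum_add, primitive_apply, corolla_eq]
  congr 1
  · have := map_cutSum ((TensorProduct.mk K W W).flip (one K)) (fun p q =>
      (-1 : K) ^ p.length • left (K := K) (right (K := K) (nearrow K p) x) (searrow K q)) l
    simp only [LinearMap.flip_apply, TensorProduct.mk_apply] at this
    rw [this]
    simp [TensorProduct.smul_tmul']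
  · rw [cutSum_assoc (fun a b q => cutSum (fun c d => (-1 : K) ^ (a.length + b.length) •
        (star K W (nearrow K b) (searrow K c) ⊗ₜ[K]
          left (K := K) (right (K := K) (nearrow K a) x) (searrow K d))) q)]
    have := map_cutSum (TensorProduct.mk K W W (one K)) (fun p q =>
      (-1 : K) ^ p.length • left (K := K) (right (K := K) (nearrow K p) x) (searrow K q)) l
    simp only [TensorProduct.mk_apply] at this
    rw [this]
    refine cutSum_congr l fun a m hm => ?_
    rw [← cutSum_assoc (fun b c d => (-1 : K) ^ (a.length + b.length) •
        (star K W (nearrow K b) (searrow K c) ⊗ₜ[K]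
          left (K := K) (right (K := K) (nearrow K a) x) (searrow K d)))]
    have key : ∀ r d, cutSum (fun b c => (-1 : K) ^ (a.length + b.length) •
        (star K W (nearrow K b) (searrow K c) ⊗ₜ[K]
          left (K := K) (right (K := K) (nearrow K a) x) (searrow K d))) r =
        (-1 : K) ^ a.length • (alt (K := K) r ⊗ₜ[K]
          left (K := K) (right (K := K) (nearrow K a) x) (searrow K d)) := by
      intro r d
      have := map_cutSum ((-1 : K) ^ a.length • (TensorProduct.mk K W W).flip
        (left (K := K) (right (K := K) (nearrow K a) x) (searrow K d)))
        (fun p q => (-1 : K) ^ p.length • star K W (nearrow K p) (searrow K q)) r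
      simp only [LinearMap.smul_apply, LinearMap.flip_apply, TensorProduct.mk_apply] at this
      rw [alt, this]
      simp [pow_add, mul_smul, TensorProduct.smul_tmul']
    rw [cutSum_congr (g := fun r d => if r = [] then (-1 : K) ^ a.length • (one K ⊗ₜ[K]
          left (K := K) (right (K := K) (nearrow K a) x) (searrow K d)) else 0) m ?_,
      cutSum_left_nil]
    · simp
    · simp
    · intro r d hrd
      rw [key]
      split_ifs with h
      · subst h
        simp [alt, cutSum]
      · rw [alt_eq_zero r h fun y hy => hl y (by simp [hm, hrd, hy])]
        simp

end Corolla

/-! ### The enveloping dendriform algebra of a brace algebra -/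

section Envelope

variable (K : Type*) (B : Type*) [Field K] [AddCommGroup B] [Module K B] [BraceAlgebra K B]

/-- The elements `corolla(x; y₁, …, yₙ) - {x | y₁, …, yₙ}` of the free dendriform algebra `D(B)`,
for `n ≥ 1` and `x, y₁, …, yₙ` in `B`. The first term is computed in `K·1 ⊕ D(B)`, and lies in
`D(B)`. -/
def envRel : Set (FreeDend K B) :=
  {r | ∃ (x : B) (ys : List B), ys ≠ [] ∧
    r = Uni.proj K (corolla K (Uni.inc K (FreeDend.of K x))
      (ys.map fun y => Uni.inc K (FreeDend.of K y))) -
        FreeDend.of K (BraceAlgebra.brace K x ys)}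

/-- The enveloping dendriform algebra without unit: the quotient of `D(B)` by the dendriform ideal
generated by the relations identifying the two brace structures on `B`. -/
abbrev Env : Type _ := FreeDend K B ⧸ dendIdeal K (envRel K B)

/-- The enveloping dendriform algebra of a brace algebra, with unit: `K·1 ⊕ Env`. -/
abbrev UEnv : Type _ := Uni K (Env K B)

/-- The canonical map from `B` to its enveloping dendriform algebra. -/
def UEnv.ι : B →ₗ[K] UEnv K B :=
  Uni.inc K ∘ₗ (dendIdeal K (envRel K B)).mkQ ∘ₗ FreeDend.of K

end Envelope

/-! ### The coproduct on the enveloping algebra -/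

/-- The dendriform algebra `V` of a unital dendriform algebra `K·1 ⊕ V`. -/
abbrev Plus (K W : Type*) [Field K] [AddCommGroup W] [Module K W] [UnitalDendriform K W] :
    Submodule K W := LinearMap.ker (UnitalDendriform.aug (K := K) (W := W))

instance Plus.instDendriform (K W : Type*) [Field K] [AddCommGroup W] [Module K W]
    [UnitalDendriform K W] : Dendriform K (Plus K W) where
  left := LinearMap.mk₂ K (fun x y => ⟨UnitalDendriform.left (K := K) (x : W) (y : W),
      UnitalDendriform.aug_left _ _⟩)
    (by intros; ext; simp) (by intros; ext; simp) (by intros; ext; simp) (by intros; ext; simp)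
  right := LinearMap.mk₂ K (fun x y => ⟨UnitalDendriform.right (K := K) (x : W) (y : W),
      UnitalDendriform.aug_right _ _⟩)
    (by intros; ext; simp) (by intros; ext; simp) (by intros; ext; simp) (by intros; ext; simp)
  left_left x y z := Subtype.ext (UnitalDendriform.left_left _ _ _ x.2 y.2 z.2)
  right_left x y z := Subtype.ext (UnitalDendriform.right_left _ _ _ x.2 y.2 z.2)
  right_right x y z := Subtype.ext (UnitalDendriform.right_right _ _ _ x.2 y.2 z.2)

theorem IsUDendHom.map_corolla {K W W' : Type*} [Field K] [AddCommGroup W] [Module K W]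
    [AddCommGroup W'] [Module K W'] [UnitalDendriform K W] [UnitalDendriform K W']
    {f : W →ₗ[K] W'} (hf : IsUDendHom f) (x : W) (ys : List W) :
    f (corolla K x ys) = corolla K (f x) (ys.map f) := by
  have hn : ∀ l : List W, f (nearrow K l) = nearrow K (l.map f) := fun l => by
    induction l with
    | nil => exact hf.map_one
    | cons x l ih => simp [hf.map_left', ih]
  have hs : ∀ l : List W, f (searrow K l) = searrow K (l.map f) := fun l => by
    induction l using List.reverseRecOn with
    | nil => exact hf.map_one
    | append_singleton l x ih => simp [hf.map_right', ih]
  simp [corolla, hf.map_left', hf.map_right', hn, hs]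

section Coproduct

open UnitalDendriform

variable (K : Type*) {B : Type*} [Field K] [AddCommGroup B] [Module K B] [BraceAlgebra K B]

namespace UEnv

theorem aug_ι (x : B) : aug (K := K) (ι K B x) = 0 := rfl

variable (B) in
/-- The quotient map `K·1 ⊕ D(B) → K·1 ⊕ Env B`. -/
def quot : Uni K (FreeDend K B) →ₗ[K] UEnv K B :=
  Uni.extend K (Uni.inc K ∘ₗ (dendIdeal K (envRel K B)).mkQ)

theorem isUDendHom_quot : IsUDendHom (quot K B) :=
  Uni.isUDendHom_extend K (fun _ => rfl)
    (fun x y => by simp only [LinearMap.comp_apply, mkQ_left, Uni.left_inc])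
    (fun x y => by simp only [LinearMap.comp_apply, mkQ_right, Uni.right_inc])

theorem quot_of (x : B) : quot K B (Uni.inc K (FreeDend.of K x)) = ι K B x :=
  Uni.extend_inc K _ _

/-- In the enveloping algebra, the dendriform braces of elements of `B` are their braces. -/
theorem corolla_ι (x : B) (ys : List B) (h : ys ≠ []) :
    corolla K (ι K B x) (ys.map (ι K B)) = ι K B (BraceAlgebra.brace K x ys) := by
  have h1 := (isUDendHom_quot K (B := B)).map_corolla (Uni.inc K (FreeDend.of K x))
    (ys.map fun y => Uni.inc K (FreeDend.of K y))
  rw [List.map_map, quot_of] at h1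
  have h2 : (quot K B ∘ fun y => Uni.inc K (FreeDend.of K y)) = ι K B :=
    funext fun y => quot_of K y
  rw [h2] at h1
  rw [← h1, ← Uni.inc_proj K (aug_corolla (K := K) (W := Uni K (FreeDend K B)) _ _), quot,
    Uni.extend_inc]
  refine congrArg (Uni.inc K) ?_
  refine (Submodule.Quotient.eq _).2 (subset_dendIdeal _ ⟨x, ys, h, rfl⟩)

variable (B) in
/-- The dendriform morphism `D(B) → (UEnv B ⊗ UEnv B)⁺` sending `x` in `B` to
`x ⊗ 1 + 1 ⊗ x`. -/
def preComul : FreeDend K B →ₗ[K] UEnv K B ⊗[K] UEnv K B :=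
  (Plus K (UEnv K B ⊗[K] UEnv K B)).subtype ∘ₗ FreeDend.lift
    ((primitive (K := K) ∘ₗ ι K B).codRestrict (Plus K (UEnv K B ⊗[K] UEnv K B))
      (fun x => aug_primitive (aug_ι K x)))

theorem aug_preComul (x : FreeDend K B) : aug (K := K) (preComul K B x) = 0 :=
  (FreeDend.lift ((primitive (K := K) ∘ₗ ι K B).codRestrict (Plus K (UEnv K B ⊗[K] UEnv K B))
    (fun x => aug_primitive (aug_ι K x))) x).2

theorem preComul_left (x y : FreeDend K B) : preComul K B (Dendriform.left (K := K) x y) =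
    left (K := K) (preComul K B x) (preComul K B y) := by
  simp only [preComul, LinearMap.comp_apply, FreeDend.lift_left]
  rfl

theorem preComul_right (x y : FreeDend K B) : preComul K B (Dendriform.right (K := K) x y) =
    right (K := K) (preComul K B x) (preComul K B y) := by
  simp only [preComul, LinearMap.comp_apply, FreeDend.lift_right]
  rfl

theorem preComul_of (x : B) : preComul K B (FreeDend.of K x) = primitive (K := K) (ι K B x) := rfl

/-- The ideal defining the enveloping algebra is a coideal. -/
theorem dendIdeal_le_ker : dendIdeal K (envRel K B) ≤ LinearMap.ker (preComul K B) := by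
  refine dendIdeal_le ?_ ?_
  · rintro _ ⟨x, ys, h, rfl⟩
    have hom := Uni.isUDendHom_extend K (aug_preComul K (B := B)) (preComul_left K)
      (preComul_right K)
    have h1 := hom.map_corolla (Uni.inc K (FreeDend.of K x))
      (ys.map fun y => Uni.inc K (FreeDend.of K y))
    rw [← Uni.inc_proj K (aug_corolla (K := K) (W := Uni K (FreeDend K B)) _ _), Uni.extend_inc,
      Uni.extend_inc, List.map_map] at h1
    have h2 : (Uni.extend K (preComul K B) ∘ fun y => Uni.inc K (FreeDend.of K y)) =
        primitive (K := K) ∘ ι K B := funext fun y => Uni.extend_inc K _ _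
    rw [h2, preComul_of, ← List.map_map, corolla_primitive _ _ (aug_ι K x) (by simp [aug_ι]),
      corolla_ι K x ys h, ← preComul_of] at h1
    simp only [SetLike.mem_coe, LinearMap.mem_ker, map_sub, h1, sub_self]
  · intro a ha w
    simp only [LinearMap.mem_ker] at ha ⊢
    simp [preComul_left, preComul_right, ha]

variable (B) in
/-- The coproduct of the enveloping algebra: the morphism of unital dendriform algebras
`UEnv B → UEnv B ⊗ UEnv B` for which the elements of `B` are primitive. -/
def comul : UEnv K B →ₗ[K] UEnv K B ⊗[K] UEnv K B :=
  Uni.extend K ((dendIdeal K (envRel K B)).liftQ (preComul K B) (dendIdeal_le_ker K))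

theorem isUDendHom_comul : IsUDendHom (comul K B) := by
  refine Uni.isUDendHom_extend K (fun x => ?_) (fun x y => ?_) (fun x y => ?_)
  · obtain ⟨x, rfl⟩ := Submodule.mkQ_surjective _ x
    exact aug_preComul K x
  · obtain ⟨x, rfl⟩ := Submodule.mkQ_surjective _ x
    obtain ⟨y, rfl⟩ := Submodule.mkQ_surjective _ y
    exact preComul_left K x y
  · obtain ⟨x, rfl⟩ := Submodule.mkQ_surjective _ x
    obtain ⟨y, rfl⟩ := Submodule.mkQ_surjective _ y
    exact preComul_right K x y

theorem comul_ι (x : B) : comul K B (ι K B x) = ι K B x ⊗ₜ[K] one K + one K ⊗ₜ[K] ι K B x :=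
  Uni.extend_inc K _ _

/-- A morphism of unital dendriform algebras out of `UEnv B` is determined by its values
on `B`. -/
theorem hom_ext {W : Type*} [AddCommGroup W] [Module K W] [UnitalDendriform K W]
    {f g : UEnv K B →ₗ[K] W} (hf : IsUDendHom f) (hg : IsUDendHom g)
    (h : ∀ x, f (ι K B x) = g (ι K B x)) : f = g := by
  have key : ∀ d : FreeDend K B, f (Uni.inc K ((dendIdeal K (envRel K B)).mkQ d)) =
      g (Uni.inc K ((dendIdeal K (envRel K B)).mkQ d)) := by
    intro d
    induction d using FreeDend.induction with
    | of v => exact h v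
    | zero => simp
    | add a b ha hb => simp only [map_add, ha, hb]
    | smul c a ha => simp only [map_smul, ha]
    | left a b ha hb => rw [mkQ_left, ← Uni.left_inc, hf.map_left', hg.map_left', ha, hb]
    | right a b ha hb => rw [mkQ_right, ← Uni.right_inc, hf.map_right', hg.map_right', ha, hb]
  ext x
  obtain ⟨y, hy⟩ := Submodule.mkQ_surjective _ (Uni.proj K x)
  rw [Uni.eq_one_add_inc K x, ← hy, map_add, map_add, map_smul, map_smul, hf.map_one, hg.map_one,
    key]

/-- The coalgebra structure of the enveloping algebra; the counit is the projection on `K·1`. -/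
instance instCoalgebra : Coalgebra K (UEnv K B) where
  comul := comul K B
  counit := aug
  coassoc := by
    have hc := isUDendHom_comul K (B := B)
    refine hom_ext K (IsUDendHom.assoc.comp ((hc.tensor IsUDendHom.id).comp hc))
      ((IsUDendHom.id.tensor hc).comp hc) fun x => ?_
    have h1 : comul K B (one K) = one K ⊗ₜ[K] one K := hc.map_one
    simp [comul_ι, h1, TensorProduct.add_tmul, TensorProduct.tmul_add, add_assoc]
  rTensor_counit_comp_comul := by
    have h : (TensorProduct.lid K (UEnv K B)).toLinearMap ∘ₗ
        (aug (K := K) (W := UEnv K B)).rTensor (UEnv K B) ∘ₗ comul K B = LinearMap.id := by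
      refine hom_ext K (IsUDendHom.lid.comp (isUDendHom_comul K)) IsUDendHom.id fun x => ?_
      simp [comul_ι, aug_ι, aug_one]
    ext x
    apply (TensorProduct.lid K (UEnv K B)).injective
    simpa using LinearMap.congr_fun h x
  lTensor_counit_comp_comul := by
    have h : (TensorProduct.rid K (UEnv K B)).toLinearMap ∘ₗ
        (aug (K := K) (W := UEnv K B)).lTensor (UEnv K B) ∘ₗ comul K B = LinearMap.id := by
      refine hom_ext K (IsUDendHom.rid.comp (isUDendHom_comul K)) IsUDendHom.id fun x => ?_
      simp [comul_ι, aug_ι, aug_one]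
    ext x
    apply (TensorProduct.rid K (UEnv K B)).injective
    simpa using LinearMap.congr_fun h x

end UEnv

end Coproduct

/-! ### The free unital Zinbiel algebra -/

/-- The free unital Zinbiel algebra `K·1 ⊕ Z(V)`, seen as a symmetric unital dendriform
algebra. -/
abbrev UZin (K V : Type*) [Field K] [AddCommGroup V] [Module K V] : Type _ := Uni K (FreeZin K V)

/-- The inclusion of `V` in the free unital Zinbiel algebra. -/
def UZin.ι (K V : Type*) [Field K] [AddCommGroup V] [Module K V] : V →ₗ[K] UZin K V :=
  Uni.inc K ∘ₗ FreeZin.of K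

/-! ### The tensor coalgebra -/

/-- The tensor coalgebra `Tᶜ(V)`: the vector space `⨁ V^{⊗ n}`, with deconcatenation. -/
def TensorCoalgebra (K V : Type*) [Field K] [AddCommGroup V] [Module K V] : Type _ :=
  TensorAlgebra K V

namespace TensorCoalgebra

variable (K V : Type*) [Field K] [AddCommGroup V] [Module K V]

instance instAddCommGroup : AddCommGroup (TensorCoalgebra K V) :=
  inferInstanceAs (AddCommGroup (TensorAlgebra K V))

instance instModule : Module K (TensorCoalgebra K V) :=
  inferInstanceAs (Module K (TensorAlgebra K V))

/-- The identity map from the tensor algebra to the tensor coalgebra. -/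
def ofAlg : TensorAlgebra K V ≃ₗ[K] TensorCoalgebra K V := LinearEquiv.refl K _

variable {V}

/-- The word `v₁ ⊗ ⋯ ⊗ vₙ`. -/
def word (l : List V) : TensorCoalgebra K V := ofAlg K V (l.map (TensorAlgebra.ι K)).prod

/-- Left concatenation with a letter. -/
def cons : V →ₗ[K] TensorCoalgebra K V →ₗ[K] TensorCoalgebra K V :=
  (LinearMap.mul K (TensorAlgebra K V)) ∘ₗ TensorAlgebra.ι K

theorem cons_word (v : V) (l : List V) : cons K v (word K l) = word K (v :: l) := by
  simp only [word, List.map_cons, List.prod_cons]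
  rfl

@[elab_as_elim]
theorem induction {p : TensorCoalgebra K V → Prop} (nil : p (word K []))
    (cons : ∀ v w, p w → p (cons K v w)) (add : ∀ a b, p a → p b → p (a + b))
    (smul : ∀ (c : K) a, p a → p (c • a)) (x : TensorCoalgebra K V) : p x := by
  have key : ∀ a : TensorAlgebra K V, ∀ w : TensorAlgebra K V, p w → p (a * w : TensorAlgebra K V) := by
    intro a
    induction a using TensorAlgebra.induction with
    | algebraMap r =>
      intro w hw
      rw [← Algebra.smul_def]
      exact smul r w hw
    | ι v => exact fun w hw => cons v w hw
    | mul a b ha hb =>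
      intro w hw
      rw [mul_assoc]
      exact ha _ (hb _ hw)
    | add a b ha hb =>
      intro w hw
      rw [add_mul]
      exact add _ _ (ha w hw) (hb w hw)
  exact (mul_one (M := TensorAlgebra K V) x) ▸ key x (1 : TensorAlgebra K V) nil

variable (V) in
/-- For each letter `v`, the operator `(w, t) ↦ (v w, 1 ⊗ v w + (v ⊗ 1) t)`. -/
def step : V →ₗ[K] Module.End K
    (TensorCoalgebra K V × TensorCoalgebra K V ⊗[K] TensorCoalgebra K V) :=
  LinearMap.mk₂ K (fun v x => (cons K v x.1,
      word K [] ⊗ₜ[K] cons K v x.1 + (cons K v).rTensor (TensorCoalgebra K V) x.2))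
    (by
      intros
      simp only [map_add, LinearMap.add_apply, LinearMap.rTensor_add, TensorProduct.tmul_add,
        Prod.mk_add_mk]
      congr 1
      abel)
    (by
      intros
      simp only [map_smul, LinearMap.smul_apply, LinearMap.rTensor_smul, TensorProduct.tmul_smul,
        Prod.smul_mk, smul_add])
    (by
      intros
      simp only [Prod.fst_add, Prod.snd_add, map_add, TensorProduct.tmul_add, Prod.mk_add_mk]
      congr 1
      abel)
    (by
      intros
      simp only [Prod.smul_fst, Prod.smul_snd, map_smul, TensorProduct.tmul_smul, Prod.smul_mk,
        smul_add])

/-- The deconcatenation coproduct, defined by recursion on words through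
`Δ(1) = 1 ⊗ 1` and `Δ(v w) = 1 ⊗ v w + (v ⊗ 1) Δ(w)`; see `deconc_word` for the closed
formula. -/
def deconc : TensorCoalgebra K V →ₗ[K] TensorCoalgebra K V ⊗[K] TensorCoalgebra K V :=
  LinearMap.snd K _ _ ∘ₗ
    LinearMap.applyₗ ((word K [] : TensorCoalgebra K V),
      (word K [] ⊗ₜ[K] word K [] : TensorCoalgebra K V ⊗[K] TensorCoalgebra K V)) ∘ₗ
    (TensorAlgebra.lift K (step K V)).toLinearMap ∘ₗ (ofAlg K V).symm.toLinearMap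

/-- The counit: the projection on `V^{⊗ 0}`. -/
def counit : TensorCoalgebra K V →ₗ[K] K :=
  TensorAlgebra.algebraMapInv.toLinearMap ∘ₗ (ofAlg K V).symm.toLinearMap

theorem deconc_nil : deconc K (word K ([] : List V)) = word K [] ⊗ₜ[K] word K [] := by
  have : (ofAlg K V).symm (word K []) = 1 := rfl
  simp [deconc, this]

theorem deconc_cons (v : V) (w : TensorCoalgebra K V) : deconc K (cons K v w) =
    word K [] ⊗ₜ[K] cons K v w + (cons K v).rTensor (TensorCoalgebra K V) (deconc K w) := by
  have h : ∀ w : TensorCoalgebra K V, (TensorAlgebra.lift K (step K V) ((ofAlg K V).symm w)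
      (word K [], word K [] ⊗ₜ[K] word K [])).1 = w := by
    intro w
    induction w using induction K with
    | nil =>
      have : (ofAlg K V).symm (word K []) = 1 := rfl
      simp [this]
    | cons v w ih =>
      have : (ofAlg K V).symm (cons K v w) = TensorAlgebra.ι K v * (ofAlg K V).symm w := rfl
      rw [this, map_mul, Module.End.mul_apply, TensorAlgebra.lift_ι_apply]
      change cons K v _ = _
      rw [ih]
    | add a b ha hb => simp only [map_add, LinearMap.add_apply, Prod.fst_add, ha, hb]
    | smul c a ha => simp only [map_smul, LinearMap.smul_apply, Prod.smul_fst, ha]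
  have h2 : (ofAlg K V).symm (cons K v w) = TensorAlgebra.ι K v * (ofAlg K V).symm w := rfl
  change (TensorAlgebra.lift K (step K V) ((ofAlg K V).symm (cons K v w)) _).2 = _
  rw [h2, map_mul, Module.End.mul_apply, TensorAlgebra.lift_ι_apply]
  change word K [] ⊗ₜ[K] cons K v _ + _ = _
  rw [h]
  rfl

/-- `Δ(v₁ ⊗ ⋯ ⊗ vₙ) = ∑ (v₁ ⊗ ⋯ ⊗ vᵢ) ⊗ (vᵢ₊₁ ⊗ ⋯ ⊗ vₙ)`, the sum being over `0 ≤ i ≤ n`. -/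
theorem deconc_word (l : List V) : deconc K (word K l) =
    ∑ i ∈ Finset.range (l.length + 1), word K (l.take i) ⊗ₜ[K] word K (l.drop i) := by
  rw [← cutSum_eq (fun p q => word K p ⊗ₜ[K] word K q)]
  induction l with
  | nil => exact deconc_nil K
  | cons v l ih =>
    rw [← cons_word, deconc_cons, ih, map_cutSum, cutSum]
    simp [cons_word]

theorem counit_nil : counit K (word K ([] : List V)) = 1 := by
  have : (ofAlg K V).symm (word K []) = 1 := rfl
  simp [counit, this]

theorem counit_cons (v : V) (w : TensorCoalgebra K V) : counit K (cons K v w) = 0 := by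
  have h : (ofAlg K V).symm (cons K v w) = TensorAlgebra.ι K v * (ofAlg K V).symm w := rfl
  simp [counit, h, TensorAlgebra.algebraMapInv]

instance instCoalgebra : Coalgebra K (TensorCoalgebra K V) where
  comul := deconc K
  counit := counit K
  coassoc := by
    ext x
    simp only [LinearMap.comp_apply, LinearEquiv.coe_coe]
    induction x using induction K with
    | nil => simp [deconc_nil]
    | cons v w ih =>
      have h1 : ∀ t : TensorCoalgebra K V ⊗[K] TensorCoalgebra K V,
          TensorProduct.assoc K _ _ _ ((deconc K).rTensor _ ((cons K v).rTensor _ t)) =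
          word K [] ⊗ₜ[K] (cons K v).rTensor _ t + (cons K v).rTensor _
            (TensorProduct.assoc K _ _ _ ((deconc K).rTensor _ t)) := by
        intro t
        induction t with
        | zero => simp
        | add a b ha hb =>
          simp only [map_add, ha, hb, TensorProduct.tmul_add]
          abel
        | tmul a b =>
          have h3 : ∀ s : TensorCoalgebra K V ⊗[K] TensorCoalgebra K V,
              TensorProduct.assoc K _ _ _ ((cons K v).rTensor _ s ⊗ₜ[K] b) =
              (cons K v).rTensor _ (TensorProduct.assoc K _ _ _ (s ⊗ₜ[K] b)) := by
            intro s
            induction s with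
            | zero => simp
            | add a b ha hb => simp only [map_add, TensorProduct.add_tmul, ha, hb]
            | tmul a b => simp
          simp only [LinearMap.rTensor_tmul, deconc_cons, TensorProduct.add_tmul, map_add, h3,
            TensorProduct.assoc_tmul]
      have h2 : ∀ t : TensorCoalgebra K V ⊗[K] TensorCoalgebra K V,
          (deconc K).lTensor _ ((cons K v).rTensor _ t) =
            (cons K v).rTensor _ ((deconc K).lTensor (TensorCoalgebra K V) t) := by
        intro t
        induction t with
        | zero => simp
        | add a b ha hb => simp only [map_add, ha, hb]
        | tmul a b => simp
      rw [deconc_cons, map_add, map_add, map_add, h1, h2, ih, LinearMap.rTensor_tmul,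
        LinearMap.lTensor_tmul, deconc_nil, TensorProduct.assoc_tmul, deconc_cons,
        TensorProduct.tmul_add]
      abel
    | add a b ha hb => simp only [map_add, ha, hb]
    | smul c a ha => simp only [map_smul, ha]
  rTensor_counit_comp_comul := by
    ext x
    simp only [LinearMap.comp_apply, TensorProduct.mk_apply]
    induction x using induction K with
    | nil => simp [deconc_nil, counit_nil]
    | cons v w ih =>
      have h1 : ∀ t : TensorCoalgebra K V ⊗[K] TensorCoalgebra K V,
          (counit K).rTensor (TensorCoalgebra K V) ((cons K v).rTensor _ t) = 0 := by
        intro t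
        induction t with
        | zero => simp
        | add a b ha hb => simp only [map_add, ha, hb, add_zero]
        | tmul a b => simp [counit_cons]
      rw [deconc_cons, map_add, h1, LinearMap.rTensor_tmul, counit_nil, add_zero]
    | add a b ha hb => simp only [map_add, ha, hb, TensorProduct.tmul_add]
    | smul c a ha => simp only [map_smul, ha, TensorProduct.tmul_smul]
  lTensor_counit_comp_comul := by
    ext x
    simp only [LinearMap.comp_apply, LinearMap.flip_apply, TensorProduct.mk_apply]
    induction x using induction K with
    | nil => simp [deconc_nil, counit_nil]
    | cons v w ih =>
      have h2 : ∀ t : TensorCoalgebra K V ⊗[K] TensorCoalgebra K V,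
          (counit K).lTensor _ ((cons K v).rTensor _ t) =
            (cons K v).rTensor _ ((counit K).lTensor (TensorCoalgebra K V) t) := by
        intro t
        induction t with
        | zero => simp
        | add a b ha hb => simp only [map_add, ha, hb]
        | tmul a b => simp
      rw [deconc_cons, map_add, h2, ih, LinearMap.lTensor_tmul, counit_cons]
      simp
    | add a b ha hb => simp only [map_add, ha, hb, TensorProduct.add_tmul]
    | smul c a ha => simp only [map_smul, ha, TensorProduct.smul_tmul']

/-! ### Words in a unital dendriform algebra -/

section Words

variable {K} {W : Type*} [AddCommGroup W] [Module K W] [UnitalDendriform K W] (g : V →ₗ[K] W)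

/-- The linear map `v₁ ⊗ ⋯ ⊗ vₙ ↦ ((g v₁ ≻ g v₂) ≻ …) ≻ g vₙ`. In a Zinbiel algebra the image is
`g vₙ · (g vₙ₋₁ · (⋯ · g v₁))`. -/
def searrowMap : TensorCoalgebra K V →ₗ[K] W :=
  LinearMap.applyₗ (UnitalDendriform.one K) ∘ₗ (MulOpposite.opLinearEquiv K).symm.toLinearMap ∘ₗ
    (TensorAlgebra.lift K ((MulOpposite.opLinearEquiv K).toLinearMap ∘ₗ
      (UnitalDendriform.right (K := K) (W := W)).flip ∘ₗ g :
        V →ₗ[K] (Module.End K W)ᵐᵒᵖ)).toLinearMap ∘ₗ (ofAlg K V).symm.toLinearMap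

/-- The linear map `v₁ ⊗ ⋯ ⊗ vₙ ↦ g v₁ ≺ (g v₂ ≺ (… ≺ g vₙ))`. In a Zinbiel algebra the image is
`g v₁ · (g v₂ · (⋯ · g vₙ))`. -/
def nearrowMap : TensorCoalgebra K V →ₗ[K] W :=
  LinearMap.applyₗ (UnitalDendriform.one K) ∘ₗ
    (TensorAlgebra.lift K (UnitalDendriform.left (K := K) (W := W) ∘ₗ g :
        V →ₗ[K] Module.End K W)).toLinearMap ∘ₗ (ofAlg K V).symm.toLinearMap

theorem searrowMap_word (l : List V) : searrowMap g (word K l) = searrow K (l.map g) := by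
  have key : ∀ (l : List V) (a : W), (TensorAlgebra.lift K
      ((MulOpposite.opLinearEquiv K).toLinearMap ∘ₗ
        (UnitalDendriform.right (K := K) (W := W)).flip ∘ₗ g : V →ₗ[K] (Module.End K W)ᵐᵒᵖ)
      (l.map (TensorAlgebra.ι K)).prod).unop a =
      (l.map g).foldl (fun a x => UnitalDendriform.right (K := K) a x) a := by
    intro l
    induction l with
    | nil => simp
    | cons v l ih =>
      intro a
      rw [List.map_cons, List.prod_cons, map_mul, MulOpposite.unop_mul, Module.End.mul_apply, ih,
        TensorAlgebra.lift_ι_apply]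
      rfl
  exact key l _

theorem nearrowMap_word (l : List V) : nearrowMap g (word K l) = nearrow K (l.map g) := by
  have key : ∀ l : List V, TensorAlgebra.lift K (UnitalDendriform.left (K := K) (W := W) ∘ₗ g :
        V →ₗ[K] Module.End K W) (l.map (TensorAlgebra.ι K)).prod (UnitalDendriform.one K) =
      nearrow K (l.map g) := by
    intro l
    induction l with
    | nil => simp
    | cons v l ih =>
      rw [List.map_cons, List.prod_cons, map_mul, Module.End.mul_apply, ih,
        TensorAlgebra.lift_ι_apply]
      rfl
  exact key l

end Words

end TensorCoalgebra

end BraceDend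

end

/-! A unital dendriform algebra with `x ≻ y = y ≺ x` (`IsSymm`) is a Zinbiel algebra with a unit
adjoined. The point is that, for a trivial brace algebra, the relations of the enveloping algebra
say exactly that it is commutative in this sense.

Both directions compare a corolla with `x ≺ alt ys`, where `alt ys` is the alternating sum of the
products `↗(y₁,…,yᵢ) * ↘(yᵢ₊₁,…,yₙ)`, which vanishes for `n ≥ 1` (`alt_eq_zero`). Expanding
(`left_alt`), `x ≺ alt ys` is the corolla with each `↗(y₁,…,yᵢ) ≻ x` replaced by `x ≺ ↗(y₁,…,yᵢ)`.
If the algebra is commutative, the two agree and the corolla is zero (`IsSymm.corolla_eq_zero`).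
Conversely, if all corollas on generators vanish, subtracting the two sums and inducting on `n`
gives `↗(y₁,…,yₙ) ≻ x = x ≺ ↗(y₁,…,yₙ)` (`nearrow_right_eq`). From this, arbitrary words commute and
their products are combinations of words (`nearrow_symm`), so the words span the enveloping algebra
and it is commutative (`UEnv.wordSpan_eq_top`, `UEnv.isSymm`).

The enveloping algebra and the free unital Zinbiel algebra thus have the same universal property
among commutative algebras. This produces mutually inverse morphisms, hence `θ`
(`UEnv.exists_equiv`); uniqueness holds because `V` generates.

For the coalgebra statement, the coproduct is a dendriform morphism making `V` primitive, so the
coproduct of a word is the corresponding word in primitive elements. Expanding it gives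
deconcatenation for `↘` and deconcatenation with the factors exchanged for `↗`
(`UEnv.comul_searrowMap`, `UEnv.comul_nearrowMap`). It remains to see that words form a basis. They
span by the above. They are independent because the coproduct, followed by a projection onto `V` in
the second factor, peels off the first letter of a word `↗` (`retraction_left`); iterating recovers
the word (`UEnv.nearrowMap_injective`). Commutativity turns `↘` into `↗` of the reversed word, so
the same holds for `↘`. -/

noncomputable section

namespace BraceDend

/-! ### Commutative unital dendriform algebras -/

section Commutative

open UnitalDendriform

variable {K : Type*} [Field K]

/-- A unital dendriform algebra is commutative if `x ≻ y = y ≺ x` for all `x`, `y`, units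
included. -/
def IsSymm (K : Type*) (W : Type*) [Field K] [AddCommGroup W] [Module K W]
    [UnitalDendriform K W] : Prop :=
  ∀ x y : W, right (K := K) x y = left (K := K) y x

/-- The unit contributes `ε(x) y` to both `x ≻ y` and `y ≺ x`, so only the products inside `D` have
to be compared. -/
theorem Uni.isSymm {D : Type*} [AddCommGroup D] [Module K D] [Dendriform K D]
    (h : ∀ x y : D, Dendriform.right (K := K) x y = Dendriform.left (K := K) y x) :
    IsSymm K (Uni K D) := fun x y =>
  congrArg (fun z => Uni.inc K (Uni.scal K x • Uni.proj K y + z)) (h _ _)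

variable {W : Type*} [AddCommGroup W] [Module K W] [UnitalDendriform K W]

/-- The identity `x ≺ (y * z) = (x ≺ y) ≺ z`, valid with units, moves `x` into each term. The result
has the shape of a corolla with root `x` in which the products `↗ ≻ x` have become `x ≺ ↗`; it is
the bridge between commutativity and the vanishing of corollas. -/
theorem left_alt (x : W) (ys : List W) : left (K := K) x (alt (K := K) ys) =
    cutSum (fun p q => (-1 : K) ^ p.length •
      left (K := K) (left (K := K) x (nearrow K p)) (searrow K q)) ys := by
  simp [alt, map_cutSum, left_left']

/-- In a commutative unital dendriform algebra all brace operations vanish. -/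
theorem IsSymm.corolla_eq_zero (hW : IsSymm K W) (x : W) (ys : List W) (h : ys ≠ [])
    (hys : ∀ y ∈ ys, aug (K := K) y = 0) : corolla K x ys = 0 := by
  simp only [corolla_eq, hW _ x]
  rw [← left_alt, alt_eq_zero ys h hys, map_zero]

/-- Appending a last letter on the right by `≻` is, by commutativity, prepending it on the left by
`≺`. -/
theorem IsSymm.searrow_eq (hW : IsSymm K W) (l : List W) :
    searrow K l = nearrow K l.reverse := by
  induction l using List.reverseRecOn with
  | nil => rfl
  | append_singleton l x ih => simp [hW _ x, ih]

/-- If all corollas with root `x` vanish, then `x` commutes with the words `nearrow K ys`. -/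
theorem nearrow_right_eq (x : W) (S : Set W) (hS : ∀ y ∈ S, aug (K := K) y = 0)
    (hc : ∀ ys : List W, ys ≠ [] → (∀ y ∈ ys, y ∈ S) → corolla K x ys = 0)
    (hx : aug (K := K) x = 0) (ys : List W) (hys : ∀ y ∈ ys, y ∈ S) :
    right (K := K) (nearrow K ys) x = left (K := K) x (nearrow K ys) := by
  induction hn : ys.length using Nat.strong_induction_on generalizing ys with
  | _ n ih =>
  by_cases h : ys = []
  · subst h
    simp [one_right', left_one', hx]
  -- Both terms vanish. Their difference is the sum of `(-1)ⁱ (↗(y₁,…,yᵢ) ≻ x - x ≺ ↗(y₁,…,yᵢ)) ≺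
  -- ↘(yᵢ₊₁,…,yₙ)`; the induction hypothesis kills the terms with `i < n`, leaving the wanted
  -- identity at `i = n`, up to sign.
  · have h1 : corolla K x ys - left (K := K) x (alt (K := K) ys) = 0 := by
      rw [hc ys h hys, alt_eq_zero ys h fun y hy => hS y (hys y hy), map_zero, sub_zero]
    rw [corolla, left_alt, cutSum_eq, ← Finset.sum_congr rfl (g := fun i =>
      (-1 : K) ^ (ys.take i).length • left (K := K) (left (K := K) x (nearrow K (ys.take i)))
        (searrow K (ys.drop i))) (fun i _ => rfl), ← Finset.sum_sub_distrib,
      Finset.sum_range_succ, Finset.sum_eq_zero, zero_add] at h1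
    -- In the last term `↘` of the empty list is `1`, and `- ≺ 1` is the identity on elements of
    -- augmentation zero.
    · have h2 : (-1 : K) ^ ys.length • (right (K := K) (nearrow K ys) x -
          left (K := K) x (nearrow K ys)) = 0 := by
        simpa [left_one', aug_left, aug_right, ← smul_sub] using h1
      rw [smul_eq_zero, or_iff_right (pow_ne_zero _ (by simp))] at h2
      exact sub_eq_zero.1 h2
    · intro i hi
      rw [Finset.mem_range] at hi
      have hl : (ys.take i).length = i := by
        rw [List.length_take]
        omega
      rw [hl, ih i (hn ▸ hi) (ys.take i) (fun y hy => hys y (List.mem_of_mem_take hy)) hl,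
        sub_self]

/-! ### Products of words in commuting letters -/

/-- The span of the words `x₁ ≺ (x₂ ≺ (… ≺ xₙ))` with letters in `S`. -/
def wordSpan (K : Type*) {W : Type*} [Field K] [AddCommGroup W] [Module K W]
    [UnitalDendriform K W] (S : Set W) : Submodule K W :=
  Submodule.span K {w | ∃ l : List W, (∀ y ∈ l, y ∈ S) ∧ nearrow K l = w}

theorem nearrow_mem_wordSpan {S : Set W} {l : List W} (hl : ∀ y ∈ l, y ∈ S) :
    nearrow K l ∈ wordSpan K S := Submodule.subset_span ⟨l, hl, rfl⟩

theorem left_mem_wordSpan {S : Set W} {x a : W} (hx : x ∈ S) (ha : a ∈ wordSpan K S) :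
    left (K := K) x a ∈ wordSpan K S := by
  refine (Submodule.span_le (p := (wordSpan K S).comap (left (K := K) x))).2 ?_ ha
  rintro _ ⟨l, hl, rfl⟩
  exact nearrow_mem_wordSpan (l := x :: l) (by simpa using ⟨hx, hl⟩)

/-- If the elements of `S` commute with the words in `S`, then any two words in `S` commute and
their products are combinations of such words. -/
theorem nearrow_symm {S : Set W}
    (hc : ∀ x ∈ S, ∀ l : List W, (∀ y ∈ l, y ∈ S) →
      right (K := K) (nearrow K l) x = left (K := K) x (nearrow K l)) (l m : List W)
    (hl : ∀ y ∈ l, y ∈ S) (hm : ∀ y ∈ m, y ∈ S) :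
    right (K := K) (nearrow K l) (nearrow K m) = left (K := K) (nearrow K m) (nearrow K l) ∧
    right (K := K) (nearrow K m) (nearrow K l) = left (K := K) (nearrow K l) (nearrow K m) ∧
    left (K := K) (nearrow K l) (nearrow K m) ∈ wordSpan K S ∧
    left (K := K) (nearrow K m) (nearrow K l) ∈ wordSpan K S := by
  induction hn : l.length + m.length using Nat.strong_induction_on generalizing l m with
  | _ n ih =>
  -- One half of the claim, for the pair in a given order. The full claim is symmetric in `l` and
  -- `m`, so that the induction hypothesis controls both orders of a shorter pair, which is what the
  -- product `*` of that pair involves.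
  have key : ∀ l m : List W, (∀ y ∈ l, y ∈ S) → (∀ y ∈ m, y ∈ S) → l.length + m.length = n →
      right (K := K) (nearrow K l) (nearrow K m) = left (K := K) (nearrow K m) (nearrow K l) ∧
      left (K := K) (nearrow K m) (nearrow K l) ∈ wordSpan K S := by
    intro l m hl hm hn
    match m, hm, hn with
    | [], _, _ => simp
    | x :: m, hm, hn =>
      have hx := hm x (by simp)
      have hm' : ∀ y ∈ m, y ∈ S := fun y hy => hm y (by simp [hy])
      obtain ⟨h1, h2, h3, h4⟩ := ih (l.length + m.length) (by simp at hn; omega) l m hl hm' rfl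
      have h5 : star K W (nearrow K m) (nearrow K l) = star K W (nearrow K l) (nearrow K m) := by
        rw [star_apply, star_apply, h1, h2, mul_comm, add_comm (left (K := K) (nearrow K m) _)]
      have h6 : star K W (nearrow K l) (nearrow K m) ∈ wordSpan K S := by
        rw [star_apply, h1]
        exact add_mem (add_mem h3 h4)
          (Submodule.smul_mem _ _ (nearrow_mem_wordSpan (l := []) (by simp)))
      -- With `l`, `m` standing for their words: `l ≻ (x ≺ m) = (l ≻ x) ≺ m = (x ≺ l) ≺ m = x ≺ (l *
      -- m)`, while `(x ≺ m) ≺ l = x ≺ (m * l)`. The two agree since `l * m = m * l`.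
      rw [nearrow_cons, ← right_left', hc x hx l hl, left_left', left_left', h5]
      exact ⟨rfl, left_mem_wordSpan hx h6⟩
  obtain ⟨h1, h2⟩ := key l m hl hm hn
  obtain ⟨h3, h4⟩ := key m l hm hl (by omega)
  exact ⟨h1, h3, h4, h2⟩

/-- Both conclusions are linear in `a` and in `b`, which reduces them to two words and to
`nearrow_symm`. -/
theorem left_mem_of_mem {S : Set W}
    (hc : ∀ x ∈ S, ∀ l : List W, (∀ y ∈ l, y ∈ S) →
      right (K := K) (nearrow K l) x = left (K := K) x (nearrow K l)) {a b : W}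
    (ha : a ∈ wordSpan K S) (hb : b ∈ wordSpan K S) :
    right (K := K) a b = left (K := K) b a ∧ left (K := K) a b ∈ wordSpan K S := by
  induction ha using Submodule.span_induction with
  | zero => simp
  | add x y _ _ hx hy =>
    simp only [map_add, LinearMap.add_apply, hx.1, hy.1, true_and]
    exact add_mem hx.2 hy.2
  | smul c x _ hx =>
    simp only [map_smul, LinearMap.smul_apply, hx.1, true_and]
    exact Submodule.smul_mem _ _ hx.2
  | mem a ha =>
    obtain ⟨l, hl, rfl⟩ := ha
    induction hb using Submodule.span_induction with
    | zero => simp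
    | add x y _ _ hx hy =>
      simp only [map_add, LinearMap.add_apply, hx.1, hy.1, true_and]
      exact add_mem hx.2 hy.2
    | smul c x _ hx =>
      simp only [map_smul, LinearMap.smul_apply, hx.1, true_and]
      exact Submodule.smul_mem _ _ hx.2
    | mem b hb =>
      obtain ⟨m, hm, rfl⟩ := hb
      have h := nearrow_symm hc l m hl hm
      exact ⟨h.1, h.2.2.1⟩

end Commutative

/-! ### The enveloping algebra of a trivial brace algebra -/

section Trivial

open UnitalDendriform

variable {K : Type*} [Field K] {V : Type*} [AddCommGroup V] [Module K V] [BraceAlgebra K V]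

/-- The defining relations identify such a corolla with the image of a brace, which is zero. Letters
are taken in the range of `ι` so that this serves as the hypothesis of `nearrow_right_eq`. -/
theorem UEnv.corolla_eq_zero (hV : BraceAlgebra.IsTrivial K V) (x : V) (ys : List (UEnv K V))
    (h : ys ≠ []) (hys : ∀ y ∈ ys, y ∈ Set.range (ι K V)) : corolla K (ι K V x) ys = 0 := by
  obtain ⟨zs, rfl⟩ : ys ∈ Set.range (List.map (ι K V)) := by
    rw [Set.range_list_map]
    exact hys
  rw [corolla_ι K x zs (by simpa using h), hV x zs (by simpa using h), map_zero]

theorem UEnv.nearrow_right_ι (hV : BraceAlgebra.IsTrivial K V) :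
    ∀ x ∈ Set.range (ι K V), ∀ l : List (UEnv K V), (∀ y ∈ l, y ∈ Set.range (ι K V)) →
      right (K := K) (nearrow K l) x = left (K := K) x (nearrow K l) := by
  rintro _ ⟨x, rfl⟩ l hl
  exact nearrow_right_eq _ (Set.range (ι K V)) (by rintro _ ⟨y, rfl⟩; exact aug_ι K y)
    (fun ys h hys => corolla_eq_zero hV x ys h hys) (aug_ι K x) l hl

/-- The enveloping algebra of a trivial brace algebra is spanned by words. -/
theorem UEnv.wordSpan_eq_top (hV : BraceAlgebra.IsTrivial K V) :
    wordSpan K (Set.range (ι K V)) = ⊤ := by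
  have hone : (one K : UEnv K V) ∈ wordSpan K (Set.range (ι K V)) :=
    nearrow_mem_wordSpan (l := []) (by simp)
  -- The span of the words contains the generators and is closed under `≺` and `≻`, hence contains
  -- the image of the whole free dendriform algebra.
  have key : ∀ d : FreeDend K V, Uni.inc K ((dendIdeal K (envRel K V)).mkQ d) ∈
      wordSpan K (Set.range (ι K V)) := by
    intro d
    induction d using FreeDend.induction with
    | of v =>
      -- A generator is the one-letter word `v ≺ 1`.
      have := left_mem_wordSpan (K := K) (Set.mem_range_self (f := ι K V) v) hone
      rwa [left_one _ (aug_ι K v)] at this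
    | zero => simp
    | add a b ha hb =>
      simp only [map_add]
      exact add_mem ha hb
    | smul c a ha =>
      simp only [map_smul]
      exact Submodule.smul_mem _ _ ha
    | left a b ha hb =>
      rw [mkQ_left, ← Uni.left_inc]
      exact (left_mem_of_mem (nearrow_right_ι hV) ha hb).2
    | right a b ha hb =>
      rw [mkQ_right, ← Uni.right_inc, (left_mem_of_mem (nearrow_right_ι hV) ha hb).1]
      exact (left_mem_of_mem (nearrow_right_ι hV) hb ha).2
  refine (Submodule.eq_top_iff').2 fun x => ?_
  obtain ⟨y, hy⟩ := Submodule.mkQ_surjective _ (Uni.proj K x)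
  rw [Uni.eq_one_add_inc K x, ← hy]
  exact add_mem (Submodule.smul_mem _ _ hone) (key y)

/-- The enveloping algebra of a trivial brace algebra is commutative. -/
theorem UEnv.isSymm (hV : BraceAlgebra.IsTrivial K V) : IsSymm K (UEnv K V) := fun x y =>
  (left_mem_of_mem (nearrow_right_ι hV) (by rw [wordSpan_eq_top hV]; trivial)
    (by rw [wordSpan_eq_top hV]; trivial)).1

/-- A linear map from a trivial brace algebra to a commutative dendriform algebra extends to the
enveloping algebra. -/
theorem UEnv.exists_lift (hV : BraceAlgebra.IsTrivial K V) {D : Type*} [AddCommGroup D]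
    [Module K D] [Dendriform K D] (hD : IsSymm K (Uni K D)) (f : V →ₗ[K] D) :
    ∃ F : UEnv K V →ₗ[K] Uni K D, IsUDendHom F ∧ ∀ v, F (ι K V v) = Uni.inc K (f v) := by
  -- Corollas involve the unit, so the map on the free dendriform algebra is first extended to `K·1
  -- ⊕ D(V)`.
  have hom : IsUDendHom (Uni.extend K (Uni.inc K ∘ₗ FreeDend.lift f)) :=
    Uni.isUDendHom_extend K (fun _ => rfl)
      (fun x y => by simp only [LinearMap.comp_apply, FreeDend.lift_left, Uni.left_inc])
      (fun x y => by simp only [LinearMap.comp_apply, FreeDend.lift_right, Uni.right_inc])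
  have hle : dendIdeal K (envRel K V) ≤ LinearMap.ker (Uni.inc K ∘ₗ FreeDend.lift f) := by
    refine dendIdeal_le ?_ ?_
    · rintro _ ⟨x, ys, h, rfl⟩
      have h1 := hom.map_corolla (Uni.inc K (FreeDend.of K x))
        (ys.map fun y => Uni.inc K (FreeDend.of K y))
      -- A relation is a corolla minus a brace. The corolla is sent to a corolla of the commutative
      -- target, which vanishes, and the brace is zero by triviality.
      rw [hD.corolla_eq_zero _ _ (by simpa using h) (by simp [hom.map_aug, Uni.aug_inc]),
        ← Uni.inc_proj K (aug_corolla (K := K) (W := Uni K (FreeDend K V)) _ _),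
        Uni.extend_inc] at h1
      rw [SetLike.mem_coe, LinearMap.mem_ker, map_sub, h1, hV x ys h, map_zero, map_zero, sub_zero]
    · intro a ha w
      have ha' : FreeDend.lift f a = 0 := congrArg (Uni.proj K) ha
      simp [FreeDend.lift_left, FreeDend.lift_right, ha']
  refine ⟨Uni.extend K ((dendIdeal K (envRel K V)).liftQ _ hle), ?_, fun v => Uni.extend_inc K _ _⟩
  refine Uni.isUDendHom_extend K (fun x => ?_) (fun x y => ?_) (fun x y => ?_)
  · obtain ⟨x, rfl⟩ := Submodule.mkQ_surjective _ x
    rfl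
  · obtain ⟨x, rfl⟩ := Submodule.mkQ_surjective _ x
    obtain ⟨y, rfl⟩ := Submodule.mkQ_surjective _ y
    change Uni.inc K (FreeDend.lift f (Dendriform.left (K := K) x y)) =
      left (K := K) (Uni.inc K (FreeDend.lift f x)) (Uni.inc K (FreeDend.lift f y))
    rw [FreeDend.lift_left, Uni.left_inc]
  · obtain ⟨x, rfl⟩ := Submodule.mkQ_surjective _ x
    obtain ⟨y, rfl⟩ := Submodule.mkQ_surjective _ y
    change Uni.inc K (FreeDend.lift f (Dendriform.right (K := K) x y)) =
      right (K := K) (Uni.inc K (FreeDend.lift f x)) (Uni.inc K (FreeDend.lift f y))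
    rw [FreeDend.lift_right, Uni.right_inc]

end Trivial

/-! ### The universal property of the free Zinbiel algebra -/

namespace FreeZin

variable {K : Type*} [Field K] {V : Type*} [AddCommGroup V] [Module K V]

theorem induction {p : FreeZin K V → Prop} (of : ∀ v, p (of K v)) (zero : p 0)
    (add : ∀ a b, p a → p b → p (a + b)) (smul : ∀ (c : K) a, p a → p (c • a))
    (mul : ∀ a b, p a → p b → p (Zinbiel.mul (K := K) a b)) (x : FreeZin K V) : p x := by
  obtain ⟨t⟩ := x
  induction t with
  | of v => exact of v
  | zero => exact zero
  | add a b ha hb => exact add _ _ ha hb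
  | smul c a ha => exact smul c _ ha
  | mul a b ha hb => exact mul _ _ ha hb

variable {W : Type*} [AddCommGroup W] [Module K W] [Zinbiel K W] (f : V →ₗ[K] W)

/-- Evaluation of formal expressions in a Zinbiel algebra. -/
def valueOf : ZTerm K V → W
  | .of v => f v
  | .zero => 0
  | .add a b => valueOf a + valueOf b
  | .smul c a => c • valueOf a
  | .mul a b => Zinbiel.mul (K := K) (valueOf a) (valueOf b)

theorem valueOf_rel {a b : ZTerm K V} (h : ZRel K V a b) : valueOf f a = valueOf f b := by
  induction h with
  | add_comm a b => exact _root_.add_comm _ _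
  | add_assoc a b c => exact _root_.add_assoc _ _ _
  | mul_smul c d a => exact SemigroupAction.mul_smul _ _ _
  | add_smul c d a => exact _root_.add_smul _ _ _
  | mul_mul a b c => exact Zinbiel.mul_mul _ _ _
  | _ => simp_all [valueOf]

/-- A linear map to a Zinbiel algebra extends to the free Zinbiel algebra. -/
def lift : FreeZin K V →ₗ[K] W where
  toFun := Quot.lift (valueOf f) (fun _ _ h => valueOf_rel f h)
  map_add' := by
    rintro ⟨a⟩ ⟨b⟩
    rfl
  map_smul' := by
    rintro c ⟨a⟩
    rfl

theorem lift_mul (x y : FreeZin K V) : lift f (Zinbiel.mul (K := K) x y) =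
    Zinbiel.mul (K := K) (lift f x) (lift f y) := by
  obtain ⟨x⟩ := x
  obtain ⟨y⟩ := y
  rfl

end FreeZin

/-! ### The isomorphism with the free unital Zinbiel algebra -/

section Theta

open UnitalDendriform

variable {K : Type*} [Field K] {V : Type*} [AddCommGroup V] [Module K V]

theorem UZin.isSymm : IsSymm K (UZin K V) := Uni.isSymm fun _ _ => rfl

theorem UZin.hom_ext {W : Type*} [AddCommGroup W] [Module K W] [UnitalDendriform K W]
    {f g : UZin K V →ₗ[K] W} (hf : IsUDendHom f) (hg : IsUDendHom g)
    (h : ∀ x, f (ι K V x) = g (ι K V x)) : f = g := by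
  have key : ∀ d : FreeZin K V, f (Uni.inc K d) = g (Uni.inc K d) := by
    intro d
    induction d using FreeZin.induction with
    | of v => exact h v
    | zero => simp
    | add a b ha hb => simp only [map_add, ha, hb]
    | smul c a ha => simp only [map_smul, ha]
    | mul a b ha hb =>
      have := Uni.left_inc K a b
      -- The product `≺` of the free Zinbiel algebra is the Zinbiel product by definition, so
      -- compatibility with `≺` alone is enough.
      change _ = Uni.inc K (Zinbiel.mul (K := K) a b) at this
      rw [← this, hf.map_left', hg.map_left', ha, hb]
  ext x
  rw [Uni.eq_one_add_inc K x, map_add, map_add, map_smul, map_smul, hf.map_one, hg.map_one, key]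

/-- When `y ≻ z = z ≺ y`, the first dendriform axiom for `≺` becomes the Zinbiel identity. The
target is therefore a Zinbiel algebra under `≺`, and the universal property of the free Zinbiel
algebra applies. -/
theorem UZin.exists_lift {D : Type*} [AddCommGroup D] [Module K D] [Dendriform K D]
    (hD : IsSymm K (Uni K D)) (f : V →ₗ[K] D) :
    ∃ F : UZin K V →ₗ[K] Uni K D, IsUDendHom F ∧ ∀ v, F (ι K V v) = Uni.inc K (f v) := by
  have hD' : ∀ x y : D, Dendriform.right (K := K) x y = Dendriform.left (K := K) y x := by
    intro x y
    have := congrArg (Uni.proj K) (hD (Uni.inc K x) (Uni.inc K y))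
    rwa [Uni.right_inc, Uni.left_inc] at this
  let _ : Zinbiel K D := ⟨Dendriform.left, fun x y z => by rw [Dendriform.left_left, hD']⟩
  refine ⟨Uni.extend K (Uni.inc K ∘ₗ FreeZin.lift f), Uni.isUDendHom_extend K (fun _ => rfl)
    (fun x y => ?_) (fun x y => ?_), fun v => Uni.extend_inc K _ _⟩
  · simp only [LinearMap.comp_apply, Uni.left_inc]
    exact congrArg (Uni.inc K) (FreeZin.lift_mul f x y)
  · simp only [LinearMap.comp_apply, Uni.right_inc, hD']
    exact congrArg (Uni.inc K) (FreeZin.lift_mul f y x)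

/-- The enveloping algebra of a trivial brace algebra is the free Zinbiel algebra. -/
theorem UEnv.exists_equiv [BraceAlgebra K V] (hV : BraceAlgebra.IsTrivial K V) :
    ∃ θ : UEnv K V ≃ₗ[K] UZin K V, IsUDendHom θ.toLinearMap ∧
      ∀ v : V, θ (ι K V v) = UZin.ι K V v := by
  obtain ⟨F, hF, hFι⟩ := exists_lift hV UZin.isSymm (FreeZin.of K)
  obtain ⟨G, hG, hGι⟩ := UZin.exists_lift (isSymm hV)
    ((dendIdeal K (envRel K V)).mkQ ∘ₗ FreeDend.of K)
  -- Both composites are morphisms fixing the generators, hence identities.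
  exact ⟨LinearEquiv.ofLinearMap F G
    (UZin.hom_ext (hF.comp hG) IsUDendHom.id fun x => by
      rw [LinearMap.comp_apply, hGι]; exact hFι x)
    (hom_ext K (hG.comp hF) IsUDendHom.id fun x => by
      rw [LinearMap.comp_apply, hFι]; exact hGι x), hF, hFι⟩

end Theta

/-! ### Words and their reversal in the tensor coalgebra -/

namespace TensorCoalgebra

variable {K : Type*} [Field K] {V : Type*} [AddCommGroup V] [Module K V]

/-- The words span the tensor coalgebra. -/
theorem word_induction {p : TensorCoalgebra K V → Prop} (word : ∀ l : List V, p (word K l))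
    (add : ∀ a b, p a → p b → p (a + b)) (smul : ∀ (c : K) a, p a → p (c • a))
    (x : TensorCoalgebra K V) : p x := by
  have key : x ∈ Submodule.span K (Set.range (TensorCoalgebra.word K (V := V))) := by
    induction x using induction K with
    | nil => exact Submodule.subset_span ⟨[], rfl⟩
    | cons v w ih =>
      -- Prepending a letter is linear and sends words to words, so it preserves their span.
      refine (Submodule.span_le (p := (Submodule.span K _).comap (TensorCoalgebra.cons K v))).2
        ?_ ih
      rintro _ ⟨l, rfl⟩
      exact Submodule.subset_span ⟨v :: l, (cons_word K v l).symm⟩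
    | add a b ha hb => exact add_mem ha hb
    | smul c a ha => exact Submodule.smul_mem _ _ ha
  induction key using Submodule.span_induction with
  | mem x hx =>
    obtain ⟨l, rfl⟩ := hx
    exact word l
  | zero => simpa using smul 0 _ (word [])
  | add x y _ _ hx hy => exact add x y hx hy
  | smul c x _ hx => exact smul c x hx

theorem hom_ext {M : Type*} [AddCommGroup M] [Module K M] {f g : TensorCoalgebra K V →ₗ[K] M}
    (h : ∀ l : List V, f (word K l) = g (word K l)) : f = g := by
  ext x
  induction x using word_induction with
  | word l => exact h l
  | add a b ha hb => simp only [map_add, ha, hb]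
  | smul c a ha => simp only [map_smul, ha]

variable (K V) in
/-- Reversal of words. -/
def reverse : TensorCoalgebra K V →ₗ[K] TensorCoalgebra K V :=
  (ofAlg K V).toLinearMap ∘ₗ (MulOpposite.opLinearEquiv K).symm.toLinearMap ∘ₗ
    (TensorAlgebra.lift K ((MulOpposite.opLinearEquiv K).toLinearMap ∘ₗ TensorAlgebra.ι K :
      V →ₗ[K] (TensorAlgebra K V)ᵐᵒᵖ)).toLinearMap ∘ₗ (ofAlg K V).symm.toLinearMap

/-- The map is induced by an algebra morphism to the opposite algebra that fixes the letters, so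
products of letters come out in the reverse order. -/
theorem reverse_word (l : List V) : reverse K V (word K l) = word K l.reverse := by
  have key : TensorAlgebra.lift K ((MulOpposite.opLinearEquiv K).toLinearMap ∘ₗ
      TensorAlgebra.ι K : V →ₗ[K] (TensorAlgebra K V)ᵐᵒᵖ) (l.map (TensorAlgebra.ι K)).prod =
      MulOpposite.op (l.reverse.map (TensorAlgebra.ι K)).prod := by
    induction l with
    | nil => simp
    | cons v l ih => simp [ih]
  exact congrArg (fun a => ofAlg K V (MulOpposite.unop a)) key

theorem reverse_reverse (x : TensorCoalgebra K V) : reverse K V (reverse K V x) = x := by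
  have : reverse K V ∘ₗ reverse K V = LinearMap.id := hom_ext fun l => by simp [reverse_word]
  exact LinearMap.congr_fun this x

/-! ### Words under reversal, morphisms and the augmentation -/

section Words

open UnitalDendriform

variable {W : Type*} [AddCommGroup W] [Module K W] [UnitalDendriform K W] (g : V →ₗ[K] W)

theorem nearrowMap_nil : nearrowMap g (word K []) = one K := nearrowMap_word g []

theorem nearrowMap_cons (v : V) (w : TensorCoalgebra K V) :
    nearrowMap g (cons K v w) = left (K := K) (g v) (nearrowMap g w) := by
  induction w using word_induction with
  | word l => rw [cons_word, nearrowMap_word, nearrowMap_word, List.map_cons, nearrow_cons]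
  | add a b ha hb => simp only [map_add, ha, hb]
  | smul c a ha => simp only [map_smul, ha]

/-- This makes bijectivity and the counit for `searrowMap` consequences of the same facts for
`nearrowMap`. -/
theorem searrowMap_eq (hW : IsSymm K W) : searrowMap g = nearrowMap g ∘ₗ reverse K V :=
  hom_ext fun l => by
    simp [reverse_word, searrowMap_word, nearrowMap_word, hW.searrow_eq]

/-- Applied to the coproduct, this reduces the coproduct of a word to a word in primitive elements;
applied to `θ`, it carries words of the enveloping algebra to words of the Zinbiel algebra. -/
theorem map_nearrowMap {W' : Type*} [AddCommGroup W'] [Module K W'] [UnitalDendriform K W']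
    {f : W →ₗ[K] W'} (hf : IsUDendHom f) (w : TensorCoalgebra K V) :
    f (nearrowMap g w) = nearrowMap (f ∘ₗ g) w := by
  induction w using induction K with
  | nil => rw [nearrowMap_nil, nearrowMap_nil, hf.map_one]
  | cons v w ih => rw [nearrowMap_cons, nearrowMap_cons, hf.map_left', ih, LinearMap.comp_apply]
  | add a b ha hb => simp only [map_add, ha, hb]
  | smul c a ha => simp only [map_smul, ha]

/-- A nonempty word is a value of `≺`, on which the augmentation vanishes. -/
theorem aug_nearrowMap (w : TensorCoalgebra K V) :
    aug (K := K) (nearrowMap g w) = counit K w := by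
  induction w using induction K with
  | nil => rw [nearrowMap_nil, aug_one, counit_nil]
  | cons v w ih => rw [nearrowMap_cons, aug_left, counit_cons]
  | add a b ha hb => simp only [map_add, ha, hb]
  | smul c a ha => simp only [map_smul, ha]

theorem counit_reverse (w : TensorCoalgebra K V) : counit K (reverse K V w) = counit K w := by
  have : counit K ∘ₗ reverse K V = counit K := hom_ext fun l => by
    rw [LinearMap.comp_apply, reverse_word]
    rcases l with _ | ⟨v, l⟩
    · rfl
    · rcases h : (v :: l).reverse with _ | ⟨u, m⟩
      · simp at h
      · rw [← cons_word, ← cons_word, counit_cons, counit_cons]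
  exact LinearMap.congr_fun this w

end Words

end TensorCoalgebra

/-! ### Words form a basis of the enveloping algebra of a trivial brace algebra -/

section Basis

open UnitalDendriform TensorCoalgebra

variable {K : Type*} [Field K] {V : Type*} [AddCommGroup V] [Module K V] [BraceAlgebra K V]

/-- The projection of the enveloping algebra of a trivial brace algebra on its generators. -/
theorem UEnv.exists_proj (hV : BraceAlgebra.IsTrivial K V) :
    ∃ π : UEnv K V →ₗ[K] V, π (one K) = 0 ∧
      ∀ v q, π (left (K := K) (ι K V v) q) = aug (K := K) q • v := by
  -- With zero products `V` is a commutative dendriform algebra, so the identity of `V` extends to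
  -- the enveloping algebra; `π` is the `V`-component of this extension.
  let _ : Dendriform K V := ⟨0, 0, by simp, by simp, by simp⟩
  obtain ⟨F, hF, hFι⟩ := exists_lift hV (Uni.isSymm fun _ _ => rfl) (LinearMap.id : V →ₗ[K] V)
  refine ⟨Uni.proj K ∘ₗ F, ?_, fun v q => ?_⟩
  · rw [LinearMap.comp_apply, hF.map_one]
    exact Uni.proj_unit K
  · rw [LinearMap.comp_apply, hF.map_left', hFι, ← hF.map_aug]
    -- In `K·1 ⊕ V` with zero products, `v ≺ q` is `ε(q) v`: only the unit part of `q` contributes.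
    exact add_zero _

/-- Successive approximations of a left inverse of `nearrowMap`. -/
def retraction (π : UEnv K V →ₗ[K] V) : ℕ → UEnv K V →ₗ[K] TensorCoalgebra K V
  | 0 => 0
  | n + 1 => (aug (K := K)).smulRight (word K []) +
      TensorProduct.lift ((TensorCoalgebra.cons K).flip.compl₁₂ (retraction π n) π) ∘ₗ
        UEnv.comul K V

theorem retraction_one {π : UEnv K V →ₗ[K] V} (h1 : π (one K) = 0) (n : ℕ) :
    retraction π (n + 1) (one K) = word K [] := by
  simp [retraction, (UEnv.isUDendHom_comul K (B := V)).map_one, one_tensor, h1, aug_one]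

/-- Write `rₙ` for `retraction π n`, so that `rₙ₊₁(x)` is `ε(x)` times the empty word plus the sum
of the `rₙ(x₍₁₎)` with the letter `π(x₍₂₎)` prepended. For primitive `v`, `Δ(v ≺ x)` is the sum of
`ε(x₍₂₎) (v ≺ x₍₁₎) ⊗ 1` and `x₍₁₎ ⊗ (v ≺ x₍₂₎)`. The first part is killed by `π(1) = 0`; in the
second `π(v ≺ x₍₂₎) = ε(x₍₂₎) v`, and the counit axiom leaves `v` prepended to `rₙ(x)`. -/
theorem retraction_left {π : UEnv K V →ₗ[K] V} (h1 : π (one K) = 0)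
    (hπ : ∀ v q, π (left (K := K) (UEnv.ι K V v) q) = aug (K := K) q • v) (n : ℕ) (v : V)
    (x : UEnv K V) : retraction π (n + 1) (left (K := K) (UEnv.ι K V v) x) =
      TensorCoalgebra.cons K v (retraction π n x) := by
  have hx : (TensorProduct.rid K (UEnv K V)) ((aug (K := K)).lTensor _ (UEnv.comul K V x)) = x := by
    have := Coalgebra.lTensor_counit_comul (R := K) x
    exact (congrArg (TensorProduct.rid K (UEnv K V)) this).trans (by simp)
  have key : ∀ t : UEnv K V ⊗[K] UEnv K V,
      TensorProduct.lift ((TensorCoalgebra.cons K).flip.compl₁₂ (retraction π n) π)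
        (left (K := K) (primitive (K := K) (UEnv.ι K V v)) t) =
      TensorCoalgebra.cons K v (retraction π n
        (TensorProduct.rid K (UEnv K V) ((aug (K := K)).lTensor _ t))) := by
    intro t
    induction t with
    | zero => simp
    | add a b ha hb => simp only [map_add, ha, hb]
    | tmul p q => simp [left_primitive (UEnv.aug_ι K v), h1, hπ]
  -- The counit axiom rewrites `x` so that `key` applies with `t = Δ(x)`. The empty-word term of the
  -- recursion disappears because `v ≺ x` has augmentation zero.
  conv_rhs => rw [← hx, ← key]
  simp only [retraction, LinearMap.add_apply, LinearMap.comp_apply, LinearMap.smulRight_apply,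
    aug_left, zero_smul, zero_add, (UEnv.isUDendHom_comul K (B := V)).map_left', UEnv.comul_ι,
    primitive_apply]

/-- Each step of `retraction` restores one letter, so a word is recovered once the index exceeds its
length. Lengths are unbounded over the whole coalgebra, hence a left inverse that is only eventually
correct on each element; this is enough for a trivial kernel. -/
theorem UEnv.nearrowMap_injective (hV : BraceAlgebra.IsTrivial K V) :
    Function.Injective (nearrowMap (UEnv.ι K V)) := by
  obtain ⟨π, h1, hπ⟩ := UEnv.exists_proj hV
  have key : ∀ w : TensorCoalgebra K V, ∃ N, ∀ n ≥ N,
      retraction π n (nearrowMap (UEnv.ι K V) w) = w := by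
    intro w
    induction w using TensorCoalgebra.induction K with
    | nil =>
      -- The bound is `1` because `retraction π 0` is zero, even on the unit.
      refine ⟨1, fun n hn => ?_⟩
      obtain ⟨n, rfl⟩ := Nat.exists_eq_add_of_le' hn
      rw [nearrowMap_nil, retraction_one h1]
    | cons v w ih =>
      obtain ⟨N, hN⟩ := ih
      refine ⟨N + 1, fun n hn => ?_⟩
      obtain ⟨n, rfl⟩ := Nat.exists_eq_add_of_le' (le_of_add_le_right hn)
      rw [nearrowMap_cons, retraction_left h1 hπ, hN n (by omega)]
    | add a b ha hb =>
      obtain ⟨M, hM⟩ := ha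
      obtain ⟨N, hN⟩ := hb
      -- Requiring the identity for all large `n` makes a common index available for the two
      -- summands.
      refine ⟨max M N, fun n hn => ?_⟩
      rw [map_add, map_add, hM n (le_of_max_le_left hn), hN n (le_of_max_le_right hn)]
    | smul c a ha =>
      obtain ⟨N, hN⟩ := ha
      exact ⟨N, fun n hn => by rw [map_smul, map_smul, hN n hn]⟩
  rw [injective_iff_map_eq_zero]
  intro w hw
  obtain ⟨N, hN⟩ := key w
  rw [← hN N le_rfl, hw, map_zero]

/-- The range contains every word in the generators, and these span. -/
theorem UEnv.nearrowMap_surjective (hV : BraceAlgebra.IsTrivial K V) :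
    Function.Surjective (nearrowMap (UEnv.ι K V)) := by
  rw [← LinearMap.range_eq_top, eq_top_iff, ← wordSpan_eq_top hV, wordSpan, Submodule.span_le]
  rintro _ ⟨l, hl, rfl⟩
  obtain ⟨m, rfl⟩ : l ∈ Set.range (List.map (ι K V)) := by
    rw [Set.range_list_map]
    exact hl
  exact ⟨word K m, nearrowMap_word _ m⟩

/-- `v₁ ⊗ ⋯ ⊗ vₙ ↦ v₁ ≺ (v₂ ≺ (⋯ ≺ vₙ))` is a linear isomorphism. -/
def UEnv.nearrowEquiv (hV : BraceAlgebra.IsTrivial K V) : TensorCoalgebra K V ≃ₗ[K] UEnv K V :=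
  LinearEquiv.ofBijective (nearrowMap (ι K V)) ⟨nearrowMap_injective hV, nearrowMap_surjective hV⟩

/-- `v₁ ⊗ ⋯ ⊗ vₙ ↦ ((v₁ ≻ v₂) ≻ ⋯) ≻ vₙ` is a linear isomorphism. -/
def UEnv.searrowEquiv (hV : BraceAlgebra.IsTrivial K V) : TensorCoalgebra K V ≃ₗ[K] UEnv K V :=
  LinearEquiv.ofInvolutive (reverse K V) reverse_reverse ≪≫ₗ nearrowEquiv hV

theorem UEnv.searrowEquiv_apply (hV : BraceAlgebra.IsTrivial K V) (w : TensorCoalgebra K V) :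
    searrowEquiv hV w = searrowMap (ι K V) w := by
  rw [searrowMap_eq _ (isSymm hV)]
  rfl

/-! ### Compatibility with the coproducts -/

/-- The coproduct of a word is the word in the primitive elements `v ⊗ 1 + 1 ⊗ v`. Multiplying `p ⊗
q` by such an element acts on the second factor, except for an extra term `(v ≺ p) ⊗ 1` when `q` has
a unit part. As `↗` is built by adding letters at the front, initial segments of the word land in
the second factor, whence the exchange. -/
theorem UEnv.comul_nearrowMap (w : TensorCoalgebra K V) :
    comul K V (nearrowMap (ι K V) w) = TensorProduct.comm K _ _
      (TensorProduct.map (nearrowMap (ι K V)) (nearrowMap (ι K V)) (deconc K w)) := by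
  have hp : comul K V ∘ₗ ι K V = primitive (K := K) ∘ₗ ι K V := LinearMap.ext fun v => comul_ι K v
  rw [map_nearrowMap _ (isUDendHom_comul K), hp]
  induction w using word_induction with
  | word l =>
    rw [nearrowMap_word, LinearMap.coe_comp, ← List.map_map,
      nearrow_primitive _ (by simp [aug_ι]), cutSum_map, cutSum_eq, deconc_word]
    simp [nearrowMap_word]
  | add a b ha hb => simp only [map_add, ha, hb]
  | smul c a ha => simp only [map_smul, ha]

/-- Here too a new letter enters the second factor, apart from the term ending in `⊗ 1`, but `↘`
grows at the end of the word. Final segments land in the second factor, which is deconcatenation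
without exchange. -/
theorem UEnv.comul_searrowMap (w : TensorCoalgebra K V) :
    comul K V (searrowMap (ι K V) w) =
      TensorProduct.map (searrowMap (ι K V)) (searrowMap (ι K V)) (deconc K w) := by
  have hs : ∀ l : List (UEnv K V), comul K V (searrow K l) = searrow K (l.map (comul K V)) := by
    intro l
    induction l using List.reverseRecOn with
    | nil => exact (isUDendHom_comul K).map_one
    | append_singleton l x ih => simp [(isUDendHom_comul K (B := V)).map_right', ih]
  have hp : comul K V ∘ ι K V = primitive (K := K) ∘ ι K V := funext fun v => comul_ι K v
  induction w using word_induction with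
  | word l =>
    rw [searrowMap_word, hs, List.map_map, hp, ← List.map_map,
      searrow_primitive _ (by simp [aug_ι]), cutSum_map, cutSum_eq, deconc_word]
    simp [searrowMap_word]
  | add a b ha hb => simp only [map_add, ha, hb]
  | smul c a ha => simp only [map_smul, ha]

theorem UEnv.aug_searrowEquiv (hV : BraceAlgebra.IsTrivial K V) (w : TensorCoalgebra K V) :
    aug (K := K) (searrowEquiv hV w) = TensorCoalgebra.counit K w :=
  (aug_nearrowMap _ _).trans (counit_reverse w)

/-- The enveloping algebra of a trivial brace algebra is the tensor coalgebra. -/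
def UEnv.searrowCoalgEquiv (hV : BraceAlgebra.IsTrivial K V) :
    TensorCoalgebra K V ≃ₗc[K] UEnv K V where
  toLinearEquiv := searrowEquiv hV
  counit_comp := LinearMap.ext (aug_searrowEquiv hV)
  map_comp_comul := by
    have h : (searrowEquiv hV).toLinearMap = searrowMap (ι K V) :=
      LinearMap.ext (searrowEquiv_apply hV)
    ext w
    change TensorProduct.map (searrowEquiv hV).toLinearMap (searrowEquiv hV).toLinearMap
      (deconc K w) = comul K V ((searrowEquiv hV).toLinearMap w)
    rw [h, comul_searrowMap]

end Basis

end BraceDend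

end
-- The proposition
theorem mainTheorem5 {K : Type*} [Field K] {V : Type*} [AddCommGroup V] [Module K V]
    [BraceDend.BraceAlgebra K V] (hV : BraceDend.BraceAlgebra.IsTrivial K V) :
    ∃ θ : BraceDend.UEnv K V ≃ₗ[K] BraceDend.UZin K V,
      -- `θ` is an isomorphism of unital dendriform algebras and the identity on `V`
      (BraceDend.IsUDendHom θ.toLinearMap ∧
        ∀ v : V, θ (BraceDend.UEnv.ι K V v) = BraceDend.UZin.ι K V v) ∧
      -- it is the only one
      (∀ θ' : BraceDend.UEnv K V ≃ₗ[K] BraceDend.UZin K V,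
        BraceDend.IsUDendHom θ'.toLinearMap →
        (∀ v : V, θ' (BraceDend.UEnv.ι K V v) = BraceDend.UZin.ι K V v) → θ' = θ) ∧
      -- it is an isomorphism of coalgebras onto the tensor coalgebra, a word `v₁ ⊗ ⋯ ⊗ vₙ`
      -- being identified with `vₙ · (vₙ₋₁ · (⋯ · v₁))`
      (∃ Φ : BraceDend.UEnv K V ≃ₗc[K] BraceDend.TensorCoalgebra K V,
        ∀ x, BraceDend.TensorCoalgebra.searrowMap (BraceDend.UZin.ι K V) (Φ x) = θ x) ∧
      -- if `v₁ ⊗ ⋯ ⊗ vₙ` is identified with `v₁ · (v₂ · (⋯ · vₙ))` instead, it reverses the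
      -- two factors of the coproduct
      (∃ Ψ : BraceDend.UEnv K V ≃ₗ[K] BraceDend.TensorCoalgebra K V,
        (∀ x, BraceDend.TensorCoalgebra.nearrowMap (BraceDend.UZin.ι K V) (Ψ x) = θ x) ∧
        (∀ x, CoalgebraStruct.counit (R := K) (Ψ x) = CoalgebraStruct.counit (R := K) x) ∧
        ∀ x, CoalgebraStruct.comul (R := K) (Ψ x) =
          TensorProduct.comm K _ _ (TensorProduct.map Ψ.toLinearMap Ψ.toLinearMap
            (CoalgebraStruct.comul (R := K) x))) := by
  obtain ⟨θ, hθ, hι⟩ := BraceDend.UEnv.exists_equiv hV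
  have hc : θ.toLinearMap ∘ₗ BraceDend.UEnv.ι K V = BraceDend.UZin.ι K V := LinearMap.ext hι
  -- Being a morphism that fixes the letters, `θ` sends each word of the enveloping algebra to the
  -- same word of the Zinbiel algebra. The identifications with the tensor coalgebra can therefore
  -- be studied on the enveloping algebra.
  have hn : ∀ w, BraceDend.TensorCoalgebra.nearrowMap (BraceDend.UZin.ι K V) w =
      θ (BraceDend.UEnv.nearrowEquiv hV w) := fun w => by
    rw [← hc]
    exact (BraceDend.TensorCoalgebra.map_nearrowMap _ hθ w).symm
  refine ⟨θ, ⟨hθ, hι⟩, fun θ' hθ' hι' => ?_, ⟨(BraceDend.UEnv.searrowCoalgEquiv hV).symm,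
    fun x => ?_⟩, (BraceDend.UEnv.nearrowEquiv hV).symm, fun x => ?_, fun x => ?_, fun x => ?_⟩
  · exact LinearEquiv.toLinearMap_injective (BraceDend.UEnv.hom_ext K hθ' hθ fun v =>
      (hι' v).trans (hι v).symm)
  · obtain ⟨w, rfl⟩ : ∃ w, BraceDend.UEnv.searrowCoalgEquiv hV w = x :=
      (BraceDend.UEnv.searrowEquiv hV).surjective x
    -- The Zinbiel algebra is commutative, so `↘` is `↗` after reversal there, and `searrowEquiv` is
    -- defined as reversal followed by `nearrowEquiv`.
    rw [CoalgEquiv.symm_apply_apply,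
      BraceDend.TensorCoalgebra.searrowMap_eq _ BraceDend.UZin.isSymm, LinearMap.comp_apply, hn]
    rfl
  · rw [hn, LinearEquiv.apply_symm_apply]
  · obtain ⟨w, rfl⟩ := (BraceDend.UEnv.nearrowEquiv hV).surjective x
    rw [LinearEquiv.symm_apply_apply]
    exact (BraceDend.TensorCoalgebra.aug_nearrowMap _ w).symm
  · obtain ⟨w, rfl⟩ := (BraceDend.UEnv.nearrowEquiv hV).surjective x
    have h1 := BraceDend.UEnv.comul_nearrowMap w
    have h2 : (BraceDend.UEnv.nearrowEquiv hV).symm.toLinearMap ∘ₗ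
        BraceDend.TensorCoalgebra.nearrowMap (BraceDend.UEnv.ι K V) = LinearMap.id :=
      LinearMap.ext (BraceDend.UEnv.nearrowEquiv hV).symm_apply_apply
    change BraceDend.TensorCoalgebra.deconc K _ = TensorProduct.comm K _ _ (TensorProduct.map _ _
      (BraceDend.UEnv.comul K V (BraceDend.TensorCoalgebra.nearrowMap (BraceDend.UEnv.ι K V) w)))
    -- The exchange in the coproduct of a `↗` word cancels against the exchange in the goal, and the
    -- inverse isomorphism undoes `nearrowMap` in each factor.
    rw [LinearEquiv.symm_apply_apply, h1, TensorProduct.map_comm, ← LinearMap.comp_apply,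
      ← TensorProduct.map_comp, h2, TensorProduct.map_id, TensorProduct.comm_comm,
      LinearMap.id_apply]
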